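/- Let $R$ be a commutative ring with identity and let $C$ be a semidualizing $R$-module, that is: $C$ has a projective resolution by finitely generated projective modules, the homothety map $R\to\operatorname{Hom}_R(C,C)$ is an isomorphism, and $\operatorname{Ext}_R^{n}(C,C)=0$ for all $n\ge 1$. Let $\mathrm{Ch}(R)$ be the category of ($\mathbb{Z}$-indexed) complexes of $R$-modules, with chain maps as morphisms. A module is called $C$-projective (resp. $C$-flat) if it is isomorphic to $C\otimes_R P$ with $P$ projective (resp. to $C\otimes_R F$ with $F$ flat). A complex is called projective (resp. $C$-projective, $C$-flat) if it is exact and all its cycle modules are projective (resp. $C$-projective, $C$-flat). Write $\widetilde{\mathcal P}$, $\widetilde{\mathcal P_C}$, $\widetilde{\mathcal F_C}$ for these three classes of complexes. An exact sequence $\mathbf L$ in $\mathrm{Ch}(R)$ is called $\operatorname{Hom}(-,\widetilde{\mathcal F_C})$-exact if the sequence of abelian groups $\operatorname{Hom}_{\mathrm{Ch}(R)}(\mathbf L,H)$ is exact for every $H\in\widetilde{\mathcal F_C}$. A complex $X$ is called $D_C$-projective if there is a $\operatorname{Hom}(-,\widetilde{\mathcal F_C})$-exact exact sequence $$\cdots\to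 P_1\to P_0\xrightarrow{f_0}Q_{-1}\to Q_{-2}\to\cdots$$ in $\mathrm{Ch}(R)$ with all $P_i\in\widetilde{\mathcal P}$, all $Q_i\in\widetilde{\mathcal P_C}$ and $X\cong\operatorname{Im} f_0$. Then a complex $X\in\mathrm{Ch}(R)$ is $D_C$-projective if and only if there exists a $\operatorname{Hom}(-,\widetilde{\mathcal F_C})$-exact exact sequence $$\cdots\to W_1\xrightarrow{\sigma_1}W_0\xrightarrow{\sigma_0}W_{-1}\to\cdots$$ in $\mathrm{Ch}(R)$ such that each $W_i$ ($i\in\mathbb Z$) lies in $\widetilde{\mathcal P}\cup\widetilde{\mathcal P_C}$ and $X\cong\operatorname{Coker}\sigma_1$. -/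

import Mathlib

open CategoryTheory CategoryTheory.Limits

universe u v w

/-- An `R`-module `C` is semidualizing if it has a projective resolution by finitely generated
modules, the homothety map `R → Hom_R(C, C)` is an isomorphism, and `Ext^n_R(C, C) = 0` for all
`n ≥ 1`. -/
structure IsSemidualizing {R : Type u} [CommRing R] (C : ModuleCat.{u} R) : Prop where
  exists_resolution : ∃ P : ProjectiveResolution C, ∀ n : ℕ, Module.Finite R (P.complex.X n)
  homothety_bijective : Function.Bijective (LinearMap.lsmul R C : R → (C →ₗ[R] C))
  ext_eq_zero : ∀ n : ℕ, 1 ≤ n → Subsingleton (Abelian.Ext C C n)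

/-- The class of projective `R`-modules. -/
def projectiveModules (R : Type u) [CommRing R] : ObjectProperty (ModuleCat.{u} R) :=
  fun M => Module.Projective R M

/-- The class of `C`-projective modules: those isomorphic to `C ⊗ P` with `P` projective. -/
def cProjectiveModules {R : Type u} [CommRing R] (C : ModuleCat.{u} R) :
    ObjectProperty (ModuleCat.{u} R) :=
  fun M => ∃ P : ModuleCat.{u} R, Module.Projective R P ∧
    Nonempty (M ≅ ModuleCat.of R (TensorProduct R C P))

/-- The class of `C`-flat modules: those isomorphic to `C ⊗ F` with `F` flat. -/
def cFlatModules {R : Type u} [CommRing R] (C : ModuleCat.{u} R) :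
    ObjectProperty (ModuleCat.{u} R) :=
  fun M => ∃ F : ModuleCat.{u} R, Module.Flat R F ∧
    Nonempty (M ≅ ModuleCat.of R (TensorProduct R C F))

/-- For a class `𝒳` of modules, the class of `𝒳`-complexes: the exact complexes
`⋯ ⟶ X (n + 1) ⟶ X n ⟶ X (n - 1) ⟶ ⋯` all of whose cycle modules lie in `𝒳`. -/
def complexesOf {R : Type u} [CommRing R] (𝒳 : ObjectProperty (ModuleCat.{u} R)) :
    ObjectProperty (ChainComplex (ModuleCat.{u} R) ℤ) :=
  fun X => X.Acyclic ∧ ∀ i : ℤ, 𝒳 (X.cycles i)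

/-- A sequence `⋯ ⟶ L (i + 1) ⟶ L i ⟶ L (i - 1) ⟶ ⋯` with zero composites in an abelian category
is `Hom(-, 𝓑)`-exact if for every `B` in `𝓑` the sequence of abelian groups
`⋯ ⟶ Hom(L (i - 1), B) ⟶ Hom(L i, B) ⟶ Hom(L (i + 1), B) ⟶ ⋯` is exact. -/
def IsHomExact {A : Type w} [Category.{v} A] [Abelian A] (𝓑 : ObjectProperty A)
    (L : ChainComplex A ℤ) : Prop :=
  ∀ B : A, 𝓑 B → ∀ i : ℤ,
    Function.Exact (fun φ : L.X (i - 1) ⟶ B => L.d i (i - 1) ≫ φ)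
      (fun φ : L.X i ⟶ B => L.d (i + 1) i ≫ φ)

/-- A complex `X` is `D_C`-projective if there is an exact sequence of complexes
`⋯ ⟶ E 1 ⟶ E 0 ⟶ E (-1) ⟶ E (-2) ⟶ ⋯`, `Hom(-, 𝓑)`-exact for `𝓑` the class of `C`-flat
complexes, with `E i` a projective complex for `i ≥ 0` and a `C`-projective complex for `i < 0`,
such that `X` is isomorphic to the image of `E 0 ⟶ E (-1)`. -/
def IsDCProjectiveComplex {R : Type u} [CommRing R] (C : ModuleCat.{u} R)
    (X : ChainComplex (ModuleCat.{u} R) ℤ) : Prop :=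
  ∃ E : ChainComplex (ChainComplex (ModuleCat.{u} R) ℤ) ℤ,
    E.Acyclic ∧ IsHomExact (complexesOf (cFlatModules C)) E ∧
    (∀ i : ℤ, 0 ≤ i → complexesOf (projectiveModules R) (E.X i)) ∧
    (∀ i : ℤ, i < 0 → complexesOf (cProjectiveModules C) (E.X i)) ∧
    Nonempty (X ≅ image (E.d 0 (-1)))

-- One direction is immediate: a defining sequence of a `D_C`-projective complex is itself a mixed
-- sequence, and by exactness the image of `E 0 ⟶ E (-1)` is the cokernel of `E 1 ⟶ E 0`.
--
-- For the converse, the projective and `C`-projective terms of `W` have to be sorted. Let `𝒮`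
-- consist of the cycles of `W` and of auxiliary complexes `diskSum (N ⊗ P i)`, where `P i` is
-- projective and `N` is zero, a syzygy of `C`, or a `C`-dual of a syzygy. Every object of `𝒮` has
-- vanishing `Ext¹` into `C`-flat complexes, and continues inside `𝒮` to both sides with terms of
-- either type. Two conversions suffice (`exists_complete_resolution`). On the left, each
-- `C`-projective term is covered by a projective one with kernel in `𝒮`. Dimension shifting then
-- kills all higher `Ext` groups of `𝒮`, so any projective resolution is `Hom(-, 𝓑)`-exact. On the
-- right, each projective term embeds in a `C`-projective one with cokernel in `𝒮`. Composing
-- embeddings leaves cokernels that are extensions of objects of `𝒮`, and a horseshoe argument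
-- continues from there (`ExtensionClosure.exists_mono`).
--
-- The auxiliary modules come from the finite projective resolution of `C`. Applying `Hom(-, C)` to
-- it gives a coresolution of `R ≅ Hom(C, C)` by `C`-projectives (`isShortExactSeq_dual`).
-- Reflexivity of the syzygies and finite presentation give `Ext¹(N, C ⊗ F) = 0` for flat `F`.
-- Everything passes to complexes because projective and `C`-projective complexes are sums of disks,
-- and the disk functor is left adjoint to an exact functor.

universe u'

/-! ### Short exact sequences, the snake lemma and vanishing of Ext -/

section ShortExactSequences

open CategoryTheory.Abelian

variable {A : Type w} [Category.{v} A] [Abelian A]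

/-- The sequence `0 ⟶ X ⟶ Y ⟶ Z ⟶ 0` given by `i` and `p` is a short exact sequence. -/
def IsShortExactSeq {X Y Z : A} (i : X ⟶ Y) (p : Y ⟶ Z) : Prop :=
  ∃ h : i ≫ p = 0, (ShortComplex.mk i p h).ShortExact

namespace IsShortExactSeq

variable {X Y Z : A} {i : X ⟶ Y} {p : Y ⟶ Z}

lemma zero (h : IsShortExactSeq i p) : i ≫ p = 0 := h.1

lemma shortExact (h : IsShortExactSeq i p) : (ShortComplex.mk i p h.zero).ShortExact := h.2

lemma mono (h : IsShortExactSeq i p) : Mono i := h.shortExact.mono_f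

lemma epi (h : IsShortExactSeq i p) : Epi p := h.shortExact.epi_g

lemma of_mono (i : X ⟶ Y) [Mono i] : IsShortExactSeq i (cokernel.π i) :=
  ⟨by simp, { exact := ShortComplex.exact_cokernel i }⟩

lemma of_epi (p : Y ⟶ Z) [Epi p] : IsShortExactSeq (kernel.ι p) p :=
  ⟨by simp, { exact := ShortComplex.exact_kernel p }⟩

lemma of_biprod (X Y : A) : IsShortExactSeq (biprod.inl : X ⟶ X ⊞ Y) (biprod.snd : X ⊞ Y ⟶ Y) :=
  ⟨by simp, (ShortComplex.Splitting.ofHasBinaryBiproduct X Y).shortExact⟩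

lemma of_iso (h : IsShortExactSeq i p) {X' Y' Z' : A} {i' : X' ⟶ Y'} {p' : Y' ⟶ Z'}
    (e₁ : X ≅ X') (e₂ : Y ≅ Y') (e₃ : Z ≅ Z') (h₁ : e₁.hom ≫ i' = i ≫ e₂.hom)
    (h₂ : e₂.hom ≫ p' = p ≫ e₃.hom) : IsShortExactSeq i' p' := by
  have h' : i' ≫ p' = 0 := by
    rw [← cancel_epi e₁.hom, reassoc_of% h₁, h₂, reassoc_of% h.zero, zero_comp, comp_zero]
  exact ⟨h', ShortComplex.shortExact_of_iso (S₁ := ShortComplex.mk i p h.zero)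
    (ShortComplex.isoMk e₁ e₂ e₃ h₁ h₂) h.shortExact⟩

lemma of_iso_zero (e : X ⟶ Y) [IsIso e] (hZ : IsZero Z) : IsShortExactSeq e (0 : Y ⟶ Z) :=
  (of_mono e).of_iso (Iso.refl _) (Iso.refl _)
    (IsZero.iso (isZero_cokernel_of_epi e) hZ) (by simp) (hZ.eq_of_tgt _ _)

lemma of_zero_iso (e : Y ⟶ Z) [IsIso e] (hX : IsZero X) : IsShortExactSeq (0 : X ⟶ Y) e :=
  (of_epi e).of_iso (IsZero.iso (isZero_kernel_of_mono e) hX) (Iso.refl _)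
    (Iso.refl _) ((isZero_kernel_of_mono e).eq_of_src _ _) (by simp)

lemma precomp_iso (h : IsShortExactSeq i p) {X' : A} (e : X' ≅ X) :
    IsShortExactSeq (e.hom ≫ i) p :=
  h.of_iso e.symm (Iso.refl _) (Iso.refl _) (by simp) (by simp)

lemma postcomp_iso (h : IsShortExactSeq i p) {Z' : A} (e : Z ≅ Z') :
    IsShortExactSeq i (p ≫ e.hom) :=
  h.of_iso (Iso.refl _) (Iso.refl _) e (by simp) (by simp)

/-- A morphism killing `i` factors through `p`. -/
lemma exists_desc (h : IsShortExactSeq i p) {T : A} (f : Y ⟶ T) (hf : i ≫ f = 0) :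
    ∃ g, p ≫ g = f :=
  have := h.epi
  ⟨h.shortExact.exact.desc f hf, h.shortExact.exact.g_desc f hf⟩

/-- A morphism killed by `p` factors through `i`. -/
lemma exists_lift (h : IsShortExactSeq i p) {T : A} (f : T ⟶ Y) (hf : f ≫ p = 0) :
    ∃ g, g ≫ i = f :=
  have := h.mono
  ⟨h.shortExact.exact.lift f hf, h.shortExact.exact.lift_f f hf⟩

lemma iso_of_left (h : IsShortExactSeq i p) {Z' : A} {p' : Y ⟶ Z'} (h' : IsShortExactSeq i p') :
    Nonempty (Z ≅ Z') := by
  have := h.epi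
  have := h'.epi
  obtain ⟨f, hf⟩ := h.exists_desc p' h'.zero
  obtain ⟨g, hg⟩ := h'.exists_desc p h.zero
  exact ⟨⟨f, g, by rw [← cancel_epi p, reassoc_of% hf, hg, Category.comp_id],
    by rw [← cancel_epi p', reassoc_of% hg, hf, Category.comp_id]⟩⟩

/-- The snake lemma for a morphism of short exact sequences whose outer components are
monomorphisms. -/
lemma exists_cokernel_seq (h : IsShortExactSeq i p) {X' Y' Z' : A} {i' : X' ⟶ Y'} {p' : Y' ⟶ Z'}
    (h' : IsShortExactSeq i' p') {a : X ⟶ X'} {b : Y ⟶ Y'} {c : Z ⟶ Z'}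
    {X'' Z'' : A} {qa : X' ⟶ X''} {qc : Z' ⟶ Z''} (ha : IsShortExactSeq a qa)
    (hc : IsShortExactSeq c qc) (h₁ : i ≫ b = a ≫ i') (h₂ : b ≫ p' = p ≫ c) :
    ∃ (Y'' : A) (qb : Y' ⟶ Y'') (u : X'' ⟶ Y'') (v : Y'' ⟶ Z''),
      IsShortExactSeq b qb ∧ IsShortExactSeq u v := by
  have := h.mono
  have := h.epi
  have := h'.mono
  have := h'.epi
  have := ha.mono
  have := ha.epi
  have := hc.mono
  have := hc.epi
  have hb : Mono b := by
    rw [Preadditive.mono_iff_cancel_zero]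
    intro T t ht
    obtain ⟨s, rfl⟩ := h.exists_lift t (by
      rw [← cancel_mono c, Category.assoc, ← h₂, reassoc_of% ht, zero_comp, zero_comp])
    have : s = 0 := by
      rw [← cancel_mono a, ← cancel_mono i', Category.assoc, ← h₁, ← Category.assoc, ht]
      simp
    simp [this]
  have hq := of_mono b
  obtain ⟨u, hu⟩ := ha.exists_desc (i' ≫ cokernel.π b) (by
    rw [← Category.assoc, ← h₁, Category.assoc, cokernel.condition, comp_zero])
  obtain ⟨v, hv⟩ := hq.exists_desc (p' ≫ qc) (by
    rw [reassoc_of% h₂, hc.zero, comp_zero])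
  refine ⟨_, _, u, v, hq, ?_, ?_⟩
  · rw [← cancel_epi qa, reassoc_of% hu, hv, reassoc_of% h'.zero, zero_comp, comp_zero]
  · refine { exact := ?_, mono_f := ?_, epi_g := ?_ }
    · rw [ShortComplex.exact_iff_exact_up_to_refinements]
      intro T t ht
      dsimp at t ht
      obtain ⟨T₁, π₁, _, s, hs⟩ := surjective_up_to_refinements_of_epi (cokernel.π b) t
      obtain ⟨y, hy⟩ := hc.exists_lift (s ≫ p') (by
        rw [Category.assoc, ← hv, ← reassoc_of% hs, ht, comp_zero])
      obtain ⟨T₂, π₂, _, z, hz⟩ := surjective_up_to_refinements_of_epi p y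
      obtain ⟨x, hx⟩ := h'.exists_lift (π₂ ≫ s - z ≫ b) (by
        rw [Preadditive.sub_comp, Category.assoc, Category.assoc, h₂, ← reassoc_of% hz, hy,
          sub_self])
      refine ⟨T₂, π₂ ≫ π₁, inferInstance, x ≫ qa, ?_⟩
      dsimp
      rw [Category.assoc, hs, Category.assoc, hu, reassoc_of% hx]
      simp
    · dsimp
      rw [Preadditive.mono_iff_cancel_zero]
      intro T t ht
      obtain ⟨T₁, π₁, _, s, hs⟩ := surjective_up_to_refinements_of_epi qa t
      obtain ⟨y, hy⟩ := hq.exists_lift (s ≫ i') (by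
        rw [Category.assoc, ← hu, ← reassoc_of% hs, ht, comp_zero])
      obtain ⟨z, hz⟩ := h.exists_lift y (by
        rw [← cancel_mono c, Category.assoc, ← h₂, reassoc_of% hy, h'.zero, comp_zero, zero_comp])
      have : z ≫ a = s := by
        rw [← cancel_mono i', Category.assoc, ← h₁, reassoc_of% hz, hy]
      rw [← cancel_epi π₁, hs, ← this, Category.assoc, ha.zero, comp_zero, comp_zero]
    · dsimp
      have : Epi (cokernel.π b ≫ v) := by rw [hv]; infer_instance
      exact epi_of_epi (cokernel.π b) v

variable [HasExt.{u} A]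

/-- The long exact sequence of `Ext(-, B)` at the third object. -/
lemma subsingleton_ext_right (h : IsShortExactSeq i p) {B : A} {n : ℕ}
    (h₁ : Subsingleton (Ext X B n)) (h₂ : Subsingleton (Ext Y B (n + 1))) :
    Subsingleton (Ext Z B (n + 1)) := by
  refine subsingleton_of_forall_eq 0 fun x ↦ ?_
  obtain ⟨y, rfl⟩ := Ext.contravariant_sequence_exact₃ h.shortExact B x (Subsingleton.elim _ _)
    (add_comm 1 n)
  rw [Subsingleton.elim y 0, Ext.comp_zero]

lemma subsingleton_ext_mid (h : IsShortExactSeq i p) {B : A} {n : ℕ}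
    (h₁ : Subsingleton (Ext X B n)) (h₃ : Subsingleton (Ext Z B n)) :
    Subsingleton (Ext Y B n) := by
  refine subsingleton_of_forall_eq 0 fun x ↦ ?_
  obtain ⟨y, rfl⟩ := Ext.contravariant_sequence_exact₂ h.shortExact B x (Subsingleton.elim _ _)
  rw [Subsingleton.elim y 0, Ext.comp_zero]

lemma subsingleton_ext_left (h : IsShortExactSeq i p) {B : A} {n : ℕ}
    (h₂ : Subsingleton (Ext Y B n)) (h₃ : Subsingleton (Ext Z B (n + 1))) :
    Subsingleton (Ext X B n) := by
  refine subsingleton_of_forall_eq 0 fun x ↦ ?_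
  obtain ⟨y, rfl⟩ := Ext.contravariant_sequence_exact₁ h.shortExact B x (add_comm 1 n)
    (Subsingleton.elim _ _)
  rw [Subsingleton.elim y 0, Ext.comp_zero]

/-- The covariant long exact sequence at the middle object. -/
lemma subsingleton_ext_target (h : IsShortExactSeq i p) {B : A} {n : ℕ}
    (h₁ : Subsingleton (Ext B X n)) (h₃ : Subsingleton (Ext B Z n)) :
    Subsingleton (Ext B Y n) := by
  refine subsingleton_of_forall_eq 0 fun x ↦ ?_
  obtain ⟨y, rfl⟩ := Ext.covariant_sequence_exact₂ B h.shortExact x (Subsingleton.elim _ _)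
  rw [Subsingleton.elim y 0, Ext.zero_comp]

lemma exists_extension (h : IsShortExactSeq i p) {B : A} (h₃ : Subsingleton (Ext Z B 1))
    (f : X ⟶ B) : ∃ g : Y ⟶ B, i ≫ g = f := by
  obtain ⟨y, hy⟩ := Ext.contravariant_sequence_exact₁ h.shortExact B (Ext.mk₀ f) (add_zero 1)
    (Subsingleton.elim _ _)
  obtain ⟨g, rfl⟩ := (Ext.mk₀_bijective _ _).2 y
  refine ⟨g, (Ext.mk₀_bijective _ _).1 ?_⟩
  rw [← hy]
  exact (Ext.mk₀_comp_mk₀ i g).symm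

lemma exists_section (h : IsShortExactSeq i p) {T : A} (hT : Subsingleton (Ext T X 1))
    (f : T ⟶ Z) : ∃ g : T ⟶ Y, g ≫ p = f := by
  obtain ⟨y, hy⟩ := Ext.covariant_sequence_exact₃ T h.shortExact (Ext.mk₀ f) (zero_add 1)
    (Subsingleton.elim _ _)
  obtain ⟨g, rfl⟩ := (Ext.mk₀_bijective _ _).2 y
  refine ⟨g, (Ext.mk₀_bijective _ _).1 ?_⟩
  rw [← hy]
  exact (Ext.mk₀_comp_mk₀ g p).symm

/-- As `Ext¹(Y, B) = 0`, the connecting map `Hom(X, B) → Ext¹(Z, B)` is surjective, and it vanishes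
on morphisms that extend to `Y`. This is the converse of `exists_extension`; together they translate
between `Ext¹` and extension problems. -/
lemma subsingleton_ext_of_extension (h : IsShortExactSeq i p) {B : A}
    (h₂ : Subsingleton (Ext Y B 1)) (hB : ∀ f : X ⟶ B, ∃ g : Y ⟶ B, i ≫ g = f) :
    Subsingleton (Ext Z B 1) := by
  refine subsingleton_of_forall_eq 0 fun x ↦ ?_
  obtain ⟨y, rfl⟩ := Ext.contravariant_sequence_exact₃ h.shortExact B x (Subsingleton.elim _ _)
    (add_zero 1)
  obtain ⟨f, rfl⟩ := (Ext.mk₀_bijective _ _).2 y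
  obtain ⟨g, rfl⟩ := hB f
  rw [← Ext.mk₀_comp_mk₀, ← Ext.comp_assoc_of_second_deg_zero]
  have : h.shortExact.extClass.comp (Ext.mk₀ i) (add_zero 1) = 0 := h.shortExact.extClass_comp
  rw [this, Ext.zero_comp]

end IsShortExactSeq

lemma subsingleton_ext_of_iso [HasExt.{u} A] {X X' B : A} (e : X ≅ X') {n : ℕ}
    (h : Subsingleton (Ext X B n)) : Subsingleton (Ext X' B n) := by
  refine subsingleton_of_forall_eq 0 fun x ↦ ?_
  have : (Ext.mk₀ e.inv).comp ((Ext.mk₀ e.hom).comp x (zero_add n)) (zero_add n) = x := by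
    rw [Ext.mk₀_comp_mk₀_assoc, e.inv_hom_id, Ext.mk₀_id_comp]
  rw [← this, Subsingleton.elim ((Ext.mk₀ e.hom).comp x (zero_add n)) 0, Ext.comp_zero]

end ShortExactSequences

/-! ### Acyclic complexes, splicing and complete resolutions -/

section Complexes

open CategoryTheory.Abelian

variable {A : Type w} [Category.{v} A] [Abelian A]

lemma HomologicalComplex.Acyclic.epi_toCycles {X : ChainComplex A ℤ} (hX : X.Acyclic) {i j : ℤ}
    (h : j + 1 = i) : Epi (X.toCycles i j) := by
  have hi : (ComplexShape.down ℤ).prev j = i := (ComplexShape.down ℤ).prev_eq' h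
  rw [Preadditive.epi_iff_cancel_zero]
  intro T f hf
  obtain ⟨g, rfl⟩ := CokernelCofork.IsColimit.desc' (X.homologyIsCokernel i j hi) f hf
  exact (comp_zero (f := X.homologyπ j)) ▸
    congrArg (X.homologyπ j ≫ ·) ((hX j).isZero_homology.eq_of_src g 0)

lemma HomologicalComplex.Acyclic.isShortExactSeq {X : ChainComplex A ℤ} (hX : X.Acyclic) {i j : ℤ}
    (h : j + 1 = i) : IsShortExactSeq (X.iCycles i) (X.toCycles i j) := by
  have hj : (ComplexShape.down ℤ).next i = j := (ComplexShape.down ℤ).next_eq' h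
  have hz : X.iCycles i ≫ X.toCycles i j = 0 := by
    rw [← cancel_mono (X.iCycles j), Category.assoc, X.toCycles_i, X.iCycles_d, zero_comp]
  refine ⟨hz, { exact := ?_, mono_f := inferInstanceAs (Mono (X.iCycles i)),
                epi_g := hX.epi_toCycles h }⟩
  let φ : ShortComplex.mk _ _ hz ⟶ ShortComplex.mk _ _ (X.iCycles_d i j) :=
    { τ₁ := 𝟙 _, τ₂ := 𝟙 _, τ₃ := X.iCycles j }
  have : Epi φ.τ₁ := inferInstanceAs (Epi (𝟙 _))
  have : IsIso φ.τ₂ := inferInstanceAs (IsIso (𝟙 _))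
  have : Mono φ.τ₃ := inferInstanceAs (Mono (X.iCycles j))
  exact (ShortComplex.exact_iff_of_epi_of_isIso_of_mono φ).2
    (ShortComplex.exact_of_f_is_kernel _ (X.cyclesIsKernel i j hj))

lemma HomologicalComplex.Acyclic.nonempty_image_iso {X : ChainComplex A ℤ} (hX : X.Acyclic)
    {i j : ℤ} (h : j + 1 = i) : Nonempty (X.cycles j ≅ image (X.d i j)) := by
  have := hX.epi_toCycles h
  have := strongEpi_of_epi (X.toCycles i j)
  have e := image.isoStrongEpiMono (f := X.d i j) (X.toCycles i j) (X.iCycles j) (X.toCycles_i i j)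
  exact ⟨e⟩

lemma HomologicalComplex.Acyclic.nonempty_cokernel_iso {X : ChainComplex A ℤ} (hX : X.Acyclic)
    {i j k : ℤ} (h : j + 1 = i) (h' : i + 1 = k) :
    Nonempty (X.cycles j ≅ cokernel (X.d k i)) := by
  have := hX.epi_toCycles h'
  obtain ⟨e⟩ := (hX.isShortExactSeq h).iso_of_left (IsShortExactSeq.of_mono _)
  exact ⟨e ≪≫ (cokernelEpiComp (X.toCycles k i) (X.iCycles i)).symm ≪≫
    cokernelIsoOfEq (X.toCycles_i k i)⟩

lemma IsHomExact.exists_factor {𝓑 : ObjectProperty A} {L : ChainComplex A ℤ}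
    (hL : IsHomExact 𝓑 L) {B : A} (hB : 𝓑 B) {i j k : ℤ} (h : j + 1 = i) (h' : i + 1 = k)
    (f : L.X i ⟶ B) (hf : L.d k i ≫ f = 0) : ∃ g : L.X j ⟶ B, L.d i j ≫ g = f := by
  obtain rfl : j = i - 1 := by lia
  subst h'
  exact (hL B hB i f).1 hf

/-- Composites of differentials vanish, so only one inclusion matters; indexing from `j` upwards
avoids the subtraction `i - 1`. -/
lemma isHomExact_iff {𝓑 : ObjectProperty A} {L : ChainComplex A ℤ} :
    IsHomExact 𝓑 L ↔ ∀ (B : A), 𝓑 B → ∀ (j : ℤ) (f : L.X (j + 1) ⟶ B),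
      L.d (j + 1 + 1) (j + 1) ≫ f = 0 → ∃ g : L.X j ⟶ B, L.d (j + 1) j ≫ g = f := by
  refine ⟨fun h B hB j f hf ↦ h.exists_factor hB rfl rfl f hf, fun h B hB i f ↦ ⟨fun hf ↦ ?_, ?_⟩⟩
  · obtain ⟨j, rfl⟩ : ∃ j, i = j + 1 := ⟨i - 1, by lia⟩
    have hj : j + 1 - 1 = j := by lia
    have := h B hB j f hf
    rw [Set.mem_range, hj]
    exact this
  · rintro ⟨g, rfl⟩
    change L.d (i + 1) i ≫ L.d i (i - 1) ≫ g = 0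
    rw [L.d_comp_d_assoc, zero_comp]

/-- In an acyclic `Hom(-, 𝓑)`-exact complex, vanishing of `Ext¹(-, B)` passes from the terms to
the cycles. -/
lemma IsHomExact.subsingleton_ext_cycles [HasExt.{u} A] {𝓑 : ObjectProperty A}
    {L : ChainComplex A ℤ} (hL : IsHomExact 𝓑 L) (hL' : L.Acyclic) {B : A} (hB : 𝓑 B)
    (h : ∀ i, Subsingleton (Ext (L.X i) B 1)) (j : ℤ) : Subsingleton (Ext (L.cycles j) B 1) := by
  refine (hL'.isShortExactSeq (i := j + 1) rfl).subsingleton_ext_of_extension (h _) fun f ↦ ?_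
  -- Pulled back to `L.X (j + 2)`, the map `f` becomes a cocycle, so it factors through `L.X (j +
  -- 1)`. Since `L.X (j + 2)` covers the cycles, this factor extends `f`.
  obtain ⟨g, hg⟩ := hL.exists_factor hB (i := j + 1 + 1) rfl rfl
    (L.toCycles (j + 1 + 1) (j + 1) ≫ f) (by
      rw [← Category.assoc, L.d_toCycles, zero_comp])
  have := hL'.epi_toCycles (i := j + 1 + 1) rfl
  refine ⟨g, ?_⟩
  rw [← cancel_epi (L.toCycles (j + 1 + 1) (j + 1)), ← hg, ← Category.assoc, L.toCycles_i]

section Splice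

/-- The complex obtained by splicing short exact sequences `0 ⟶ K (i + 1) ⟶ E i ⟶ K i ⟶ 0`. -/
noncomputable def spliceComplex {K E : ℤ → A} {ι : ∀ i, K (i + 1) ⟶ E i} {π : ∀ i, E i ⟶ K i}
    (h : ∀ i, IsShortExactSeq (ι i) (π i)) : ChainComplex A ℤ :=
  ChainComplex.of E (fun n ↦ π (n + 1) ≫ ι n) fun n ↦ by
    rw [Category.assoc, reassoc_of% (h (n + 1)).zero, zero_comp, comp_zero]

variable {K : ℤ → A} {L : ChainComplex A ℤ} {ι : ∀ i, K (i + 1) ⟶ L.X i} {π : ∀ i, L.X i ⟶ K i}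
  (h : ∀ i, IsShortExactSeq (ι i) (π i)) (hd : ∀ n, L.d (n + 1) n = π (n + 1) ≫ ι n)

include h hd

lemma acyclic_of_splice : L.Acyclic := by
  intro i
  obtain ⟨j, rfl⟩ : ∃ j, i = j + 1 := ⟨i - 1, by lia⟩
  have := (h (j + 1 + 1)).epi
  have := (h j).mono
  rw [HomologicalComplex.exactAt_iff' _ (j + 1 + 1) (j + 1) j
    ((ComplexShape.down ℤ).prev_eq' rfl) ((ComplexShape.down ℤ).next_eq' rfl)]
  change (ShortComplex.mk (L.d (j + 1 + 1) (j + 1)) (L.d (j + 1) j) _).Exact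
  rw [ShortComplex.exact_iff_exact_up_to_refinements]
  intro T t ht
  replace ht : t ≫ π (j + 1) ≫ ι j = 0 := by rw [← hd]; exact ht
  obtain ⟨s, hs⟩ := (h (j + 1)).exists_lift t (by
    rw [← cancel_mono (ι j), Category.assoc, ht, zero_comp])
  obtain ⟨T₁, p, hp, y, hy⟩ := surjective_up_to_refinements_of_epi (π (j + 1 + 1)) s
  refine ⟨T₁, p, hp, y, ?_⟩
  dsimp
  rw [hd, ← reassoc_of% hy, hs]

lemma nonempty_iso_image_of_splice {i j : ℤ} (hij : j + 1 = i) :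
    Nonempty (K i ≅ image (L.d i j)) := by
  subst hij
  have := (h (j + 1)).epi
  have := (h j).mono
  have := strongEpi_of_epi (π (j + 1))
  exact ⟨image.isoStrongEpiMono (π (j + 1)) (ι j) (hd j).symm⟩

/-- A cocycle on `L.X (j + 1)` descends to `K (j + 1)`, and then extends to `L.X j` because the
cokernel `K j` has no `Ext¹` into `B`. -/
lemma isHomExact_of_splice [HasExt.{u} A] {𝓑 : ObjectProperty A}
    (hK : ∀ i B, 𝓑 B → Subsingleton (Ext (K i) B 1)) : IsHomExact 𝓑 L := by
  rw [isHomExact_iff]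
  intro B hB j f hf
  have := (h (j + 1 + 1)).epi
  obtain ⟨g, hg⟩ := (h (j + 1)).exists_desc f (by
    rw [← cancel_epi (π (j + 1 + 1)), comp_zero, ← hf, hd, Category.assoc])
  obtain ⟨k, hk⟩ := (h j).exists_extension (hK j B hB) g
  refine ⟨k, ?_⟩
  rw [hd, Category.assoc, hk, hg]

end Splice

/-- Objects that can be continued to the right in `𝓡` and to the left in `𝓛` sit in a doubly
infinite family of short exact sequences. -/
lemma exists_splice_data {𝓛 𝓡 𝓟 𝓠 : ObjectProperty A}
    (hL : ∀ X, 𝓛 X → ∃ (X' P : A) (i : X' ⟶ P) (p : P ⟶ X), IsShortExactSeq i p ∧ 𝓛 X' ∧ 𝓟 P)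
    (hR : ∀ X, 𝓡 X → ∃ (Q X' : A) (i : X ⟶ Q) (p : Q ⟶ X'), IsShortExactSeq i p ∧ 𝓡 X' ∧ 𝓠 Q)
    {X : A} (hX : 𝓛 X) (hX' : 𝓡 X) :
    ∃ (K E : ℤ → A) (ι : ∀ i, K (i + 1) ⟶ E i) (π : ∀ i, E i ⟶ K i),
      (∀ i, IsShortExactSeq (ι i) (π i)) ∧ (∀ i, 0 ≤ i → 𝓟 (E i)) ∧ (∀ i, i < 0 → 𝓠 (E i)) ∧
      (∀ i, 𝓛 (K i) ∨ 𝓡 (K i)) ∧ Nonempty (X ≅ K 0) := by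
  choose fL PL iL pL hfL using fun Y : {Y // 𝓛 Y} ↦ hL Y.1 Y.2
  choose QR fR iR pR hfR using fun Y : {Y // 𝓡 Y} ↦ hR Y.1 Y.2
  let sL : ℕ → {Y // 𝓛 Y} := fun n ↦ n.rec ⟨X, hX⟩ fun _ Y ↦ ⟨fL Y, (hfL Y).2.1⟩
  let sR : ℕ → {Y // 𝓡 Y} := fun n ↦ n.rec ⟨X, hX'⟩ fun _ Y ↦ ⟨fR Y, (hfR Y).2.1⟩
  let K : ℤ → A
    | .ofNat n => (sL n).1
    | .negSucc n => (sR (n + 1)).1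
  have key (i : ℤ) : ∃ (E : A) (ι : K (i + 1) ⟶ E) (π : E ⟶ K i),
      IsShortExactSeq ι π ∧ (0 ≤ i → 𝓟 E) ∧ (i < 0 → 𝓠 E) := by
    match i with
    | .ofNat n =>
      exact ⟨PL (sL n), iL (sL n), pL (sL n), (hfL (sL n)).1, fun _ ↦ (hfL (sL n)).2.2,
        fun h ↦ absurd h (by simp)⟩
    -- The two halves meet here: `X` is both `sL 0`, which is `K 0`, and `sR 0`.
    | .negSucc 0 =>
      exact ⟨QR (sR 0), iR (sR 0), pR (sR 0), (hfR (sR 0)).1, fun h ↦ absurd h (by simp),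
        fun _ ↦ (hfR (sR 0)).2.2⟩
    | .negSucc (n + 1) =>
      exact ⟨QR (sR (n + 1)), iR (sR (n + 1)), pR (sR (n + 1)), (hfR (sR (n + 1))).1,
        fun h ↦ absurd h (by simp), fun _ ↦ (hfR (sR (n + 1))).2.2⟩
  choose E ι π hE using key
  refine ⟨K, E, ι, π, fun i ↦ (hE i).1, fun i ↦ (hE i).2.1, fun i ↦ (hE i).2.2, ?_,
    ⟨Iso.refl X⟩⟩
  rintro (n | n)
  · exact Or.inl (sL n).2
  · exact Or.inr (sR (n + 1)).2

/-- The closure of a class of objects under extensions. -/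
inductive ExtensionClosure (𝒮 : ObjectProperty A) : A → Prop
  | of {X : A} (hX : 𝒮 X) : ExtensionClosure 𝒮 X
  | ext {X Y Z : A} {i : X ⟶ Y} {p : Y ⟶ Z} (h : IsShortExactSeq i p)
      (hX : ExtensionClosure 𝒮 X) (hZ : ExtensionClosure 𝒮 Z) : ExtensionClosure 𝒮 Y

lemma ExtensionClosure.subsingleton_ext [HasExt.{u} A] {𝒮 : ObjectProperty A} {B : A} {n : ℕ}
    (h : ∀ S, 𝒮 S → Subsingleton (Ext S B n)) {X : A} (hX : ExtensionClosure 𝒮 X) :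
    Subsingleton (Ext X B n) := by
  induction hX with
  | of hX => exact h _ hX
  | ext h _ _ hX hZ => exact h.subsingleton_ext_mid hX hZ

/-- A horseshoe argument: if the objects of `𝒮` embed into objects of `𝓠` with cokernel in the
extension closure of `𝒮`, so do the objects of this extension closure. -/
lemma ExtensionClosure.exists_mono [HasExt.{u} A] {𝒮 𝓠 : ObjectProperty A}
    (hQ : ∀ X Y, 𝓠 X → 𝓠 Y → 𝓠 (X ⊞ Y))
    (h₁ : ∀ S Q, 𝒮 S → 𝓠 Q → Subsingleton (Ext S Q 1))
    (h₂ : ∀ S, 𝒮 S → ∃ (Q S' : A) (i : S ⟶ Q) (p : Q ⟶ S'),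
      IsShortExactSeq i p ∧ ExtensionClosure 𝒮 S' ∧ 𝓠 Q) {X : A} (hX : ExtensionClosure 𝒮 X) :
    ∃ (Q X' : A) (i : X ⟶ Q) (p : Q ⟶ X'),
      IsShortExactSeq i p ∧ ExtensionClosure 𝒮 X' ∧ 𝓠 Q := by
  induction hX with
  | of hX => exact h₂ _ hX
  | @ext X Y Z i p h hX hZ ihX ihZ =>
    obtain ⟨Q₁, X', a, qa, ha, hX', hQ₁⟩ := ihX
    obtain ⟨Q₂, Z', c, qc, hc, hZ', hQ₂⟩ := ihZ
    -- The embedding of `X` into `Q₁` extends to `Y` because `Ext¹(Z, Q₁) = 0`. Paired with `p ≫ c`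
    -- it embeds `Y` into `Q₁ ⊞ Q₂`.
    obtain ⟨b, hb⟩ := h.exists_extension (hZ.subsingleton_ext fun S hS ↦ h₁ S Q₁ hS hQ₁) a
    obtain ⟨Y', q, u, v, hq, huv⟩ := h.exists_cokernel_seq (.of_biprod Q₁ Q₂) ha hc
      (b := biprod.lift b (p ≫ c)) (by ext <;> simp [hb, reassoc_of% h.zero]) (by simp)
    exact ⟨_, _, _, q, hq, .ext huv hX' hZ', hQ _ _ hQ₁ hQ₂⟩

/-- A class `𝒮` whose objects can be continued to both sides by objects of `𝓟` and `𝓠` in a mixed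
order consists of objects with a complete resolution by `𝓟` on the left and `𝓠` on the right. -/
theorem exists_complete_resolution [HasExt.{u} A] {𝓟 𝓠 𝓑 𝒮 : ObjectProperty A}
    (hP : ∀ P, 𝓟 P → Projective P) (hP' : ∀ X, ∃ (P : A) (p : P ⟶ X), 𝓟 P ∧ Epi p)
    (hQB : 𝓠 ≤ 𝓑) (hQ : ∀ X Y, 𝓠 X → 𝓠 Y → 𝓠 (X ⊞ Y))
    (hSB : ∀ S B, 𝒮 S → 𝓑 B → Subsingleton (Ext S B 1))
    (hleft : ∀ S, 𝒮 S → ∃ (S' W : A) (i : S' ⟶ W) (p : W ⟶ S),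
      IsShortExactSeq i p ∧ 𝒮 S' ∧ (𝓟 W ∨ 𝓠 W))
    (hright : ∀ S, 𝒮 S → ∃ (W S' : A) (i : S ⟶ W) (p : W ⟶ S'),
      IsShortExactSeq i p ∧ 𝒮 S' ∧ (𝓟 W ∨ 𝓠 W))
    (hPQ : ∀ W, 𝓟 W → ∃ (Q S : A) (i : W ⟶ Q) (p : Q ⟶ S), IsShortExactSeq i p ∧ 𝒮 S ∧ 𝓠 Q)
    (hQP : ∀ W, 𝓠 W → ∃ (S P : A) (i : S ⟶ P) (p : P ⟶ W), IsShortExactSeq i p ∧ 𝒮 S ∧ 𝓟 P)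
    {X : A} (hX : 𝒮 X) :
    ∃ E : ChainComplex A ℤ, E.Acyclic ∧ IsHomExact 𝓑 E ∧ (∀ i : ℤ, 0 ≤ i → 𝓟 (E.X i)) ∧
      (∀ i : ℤ, i < 0 → 𝓠 (E.X i)) ∧ Nonempty (X ≅ image (E.d 0 (-1))) := by
  -- Dimension shifting along `hleft`. A term `W` in `𝓠` is itself handled by shifting along its
  -- cover from `hQP`, whose kernel again lies in `𝒮`.
  have hSn (n : ℕ) (B : A) (hB : 𝓑 B) : ∀ S, 𝒮 S → Subsingleton (Ext S B (n + 1)) := by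
    induction n with
    | zero => exact fun S hS ↦ hSB S B hS hB
    | succ n ih =>
      intro S hS
      obtain ⟨S', W, i, p, h, hS', hW⟩ := hleft S hS
      refine h.subsingleton_ext_right (ih _ hS') ?_
      obtain hW | hW := hW
      · have := hP W hW
        exact Ext.subsingleton_of_projective _ _ _
      · obtain ⟨S'', P, i', p', h', hS'', hP''⟩ := hQP W hW
        have := hP P hP''
        exact h'.subsingleton_ext_right (ih _ hS'') (Ext.subsingleton_of_projective _ _ _)
  have hEC : ∀ X, ExtensionClosure 𝒮 X → ∃ (Q X' : A) (i : X ⟶ Q) (p : Q ⟶ X'),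
      IsShortExactSeq i p ∧ ExtensionClosure 𝒮 X' ∧ 𝓠 Q := by
    refine fun X hX ↦ hX.exists_mono hQ (fun S Q hS hQ ↦ hSB S Q hS (hQB _ hQ)) fun S hS ↦ ?_
    obtain ⟨W, S', i, p, h, hS', hW | hW⟩ := hright S hS
    · obtain ⟨Q, D, a, q, h', hD, hQ'⟩ := hPQ W hW
      -- The snake lemma for `S = S ⟶ 0` over `W ⟶ Q ⟶ D`: the cokernel of `S ⟶ W ⟶ Q` is an
      -- extension of `D` by `S'`.
      obtain ⟨Y, b, u, v, hb, huv⟩ := (IsShortExactSeq.of_iso_zero (𝟙 S)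
        (isZero_zero A)).exists_cokernel_seq h' h (.of_zero_iso (𝟙 D) (isZero_zero A))
        (b := i ≫ a) (by simp) (by simp [h'.zero])
      exact ⟨Q, Y, _, b, hb, .ext huv (.of hS') (.of hD), hQ'⟩
    · exact ⟨W, S', i, p, h, .of hS', hW⟩
  obtain ⟨K, E, ι, π, h, h₁, h₂, h₃, ⟨e⟩⟩ := exists_splice_data
    -- On the left, arbitrary covers by `𝓟` are used, so the kernels may leave `𝒮`. Only the
    -- vanishing of all positive `Ext` groups is carried along.
    (𝓛 := fun Y ↦ ∀ n B, 𝓑 B → Subsingleton (Ext Y B (n + 1))) (𝓟 := 𝓟) (fun Y hY ↦ by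
      obtain ⟨P, p, hPP, _⟩ := hP' Y
      have := hP P hPP
      exact ⟨_, P, _, p, .of_epi p, fun n B hB ↦ (IsShortExactSeq.of_epi p).subsingleton_ext_left
        (Ext.subsingleton_of_projective _ _ _) (hY (n + 1) B hB), hPP⟩) hEC
    (fun n B hB ↦ hSn n B hB _ hX) (.of hX)
  have hd (n : ℤ) : (spliceComplex h).d (n + 1) n = π (n + 1) ≫ ι n :=
    ChainComplex.of_d (X := E) (d := fun n ↦ π (n + 1) ≫ ι n) n
  obtain ⟨e'⟩ := nonempty_iso_image_of_splice (L := spliceComplex h) h hd (i := 0) (j := -1)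
    (by simp)
  refine ⟨spliceComplex h, acyclic_of_splice h hd, isHomExact_of_splice h hd fun i B hB ↦ ?_,
    h₁, h₂, ⟨e ≪≫ e'⟩⟩
  obtain h | h := h₃ i
  · exact h 0 B hB
  · exact h.subsingleton_ext (hSn 0 B hB)

end Complexes

/-! ### Direct sums of disk complexes -/

section DiskSums

open CategoryTheory.Abelian

variable {A : Type w} [Category.{v} A] [Abelian A]

lemma IsShortExactSeq.biprod_map {X Y Z X' Y' Z' : A} {i : X ⟶ Y} {p : Y ⟶ Z} {i' : X' ⟶ Y'}
    {p' : Y' ⟶ Z'} (h : IsShortExactSeq i p) (h' : IsShortExactSeq i' p') :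
    IsShortExactSeq (biprod.map i i') (biprod.map p p') := by
  have := h.mono
  have := h.epi
  have := h'.mono
  have := h'.epi
  have hz : biprod.map i i' ≫ biprod.map p p' = 0 := by ext <;> simp [h.zero, h'.zero]
  refine ⟨hz, { exact := ?_, mono_f := inferInstanceAs (Mono (biprod.map i i')),
                epi_g := inferInstanceAs (Epi (biprod.map p p')) }⟩
  rw [ShortComplex.exact_iff_exact_up_to_refinements]
  intro T t ht
  replace ht : t ≫ biprod.map p p' = 0 := ht
  obtain ⟨x, hx⟩ := h.exists_lift (t ≫ biprod.fst) (by simpa using congr($ht ≫ biprod.fst))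
  obtain ⟨y, hy⟩ := h'.exists_lift (t ≫ biprod.snd) (by simpa using congr($ht ≫ biprod.snd))
  refine ⟨T, 𝟙 T, inferInstance, biprod.lift x y, ?_⟩
  change 𝟙 T ≫ t = biprod.lift x y ≫ biprod.map i i'
  ext <;> simp [hx, hy]

lemma IsShortExactSeq.isIso_mid {X Y Z X' Y' Z' : A} {i : X ⟶ Y} {p : Y ⟶ Z} {i' : X' ⟶ Y'}
    {p' : Y' ⟶ Z'} (h : IsShortExactSeq i p) (h' : IsShortExactSeq i' p') {a : X ⟶ X'}
    {b : Y ⟶ Y'} {c : Z ⟶ Z'} [IsIso a] [IsIso c] (h₁ : i ≫ b = a ≫ i') (h₂ : b ≫ p' = p ≫ c) :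
    IsIso b :=
  ShortComplex.isIso₂_of_shortExact_of_isIso₁₃'
    (S₁ := ShortComplex.mk i p h.zero) (S₂ := ShortComplex.mk i' p' h'.zero)
    { τ₁ := a, τ₂ := b, τ₃ := c, comm₁₂ := h₁.symm, comm₂₃ := h₂ } h.shortExact h'.shortExact
    (by assumption) (by assumption)

/-- The direct sum of the disk complexes `⋯ ⟶ 0 ⟶ N i ⟶ N i ⟶ 0 ⟶ ⋯`, in degrees `i` and `i - 1`. -/
noncomputable def diskSum (N : ℤ → A) : ChainComplex A ℤ :=
  ChainComplex.of (fun n ↦ N (n + 1) ⊞ N n) (fun _ ↦ biprod.snd ≫ biprod.inl) (by simp)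

namespace diskSum

variable (N : ℤ → A)

/-- The inclusion of the cycles. -/
noncomputable def ι (i : ℤ) : N (i + 1) ⟶ (diskSum N).X i :=
  (biprod.inl : N (i + 1) ⟶ N (i + 1) ⊞ N i)

/-- The projection onto the cycles one degree below. -/
noncomputable def π (i : ℤ) : (diskSum N).X i ⟶ N i :=
  (biprod.snd : N (i + 1) ⊞ N i ⟶ N i)

/-- The canonical section of `diskSum.π`. -/
noncomputable def σ (i : ℤ) : N i ⟶ (diskSum N).X i :=
  (biprod.inr : N i ⟶ N (i + 1) ⊞ N i)

@[simp]
lemma σ_π (i : ℤ) : σ N i ≫ π N i = 𝟙 _ := biprod.inr_snd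

@[simp]
lemma σ_π_assoc (i : ℤ) {Y : A} (f : N i ⟶ Y) : σ N i ≫ π N i ≫ f = f := by
  rw [← Category.assoc, σ_π, Category.id_comp]

lemma isShortExactSeq (i : ℤ) : IsShortExactSeq (ι N i) (π N i) := .of_biprod _ _

@[simp]
lemma d_eq (i : ℤ) : (diskSum N).d (i + 1) i = π N (i + 1) ≫ ι N i :=
  ChainComplex.of_d (X := fun n ↦ N (n + 1) ⊞ N n) (d := fun _ ↦ biprod.snd ≫ biprod.inl) i

lemma acyclic : (diskSum N).Acyclic := acyclic_of_splice (isShortExactSeq N) (d_eq N)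

lemma nonempty_iso_cycles (i : ℤ) : Nonempty (N (i + 1) ≅ (diskSum N).cycles i) := by
  obtain ⟨e⟩ := nonempty_iso_image_of_splice (isShortExactSeq N) (d_eq N) (i := i + 1) rfl
  obtain ⟨e'⟩ := (acyclic N).nonempty_image_iso (i := i + 1) rfl
  exact ⟨e ≪≫ e'.symm⟩

variable {N}

lemma hom_ext_X {i : ℤ} {Y : A} {f g : (diskSum N).X i ⟶ Y} (h₁ : ι N i ≫ f = ι N i ≫ g)
    (h₂ : σ N i ≫ f = σ N i ≫ g) : f = g :=
  biprod.hom_ext' (X := N (i + 1)) (Y := N i) f g h₁ h₂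

lemma exists_desc_X {i : ℤ} {Y : A} (a : N (i + 1) ⟶ Y) (b : N i ⟶ Y) :
    ∃ f : (diskSum N).X i ⟶ Y, ι N i ≫ f = a ∧ σ N i ≫ f = b :=
  ⟨(biprod.desc a b : N (i + 1) ⊞ N i ⟶ Y), biprod.inl_desc _ _, biprod.inr_desc _ _⟩

lemma ι_eq (i : ℤ) : ι N i = σ N (i + 1) ≫ (diskSum N).d (i + 1) i := by simp

/-- The cycle summand in degree `i` is the differential of the section summand in degree `i + 1`, so
the sections determine a chain map. -/
lemma hom_ext {Y : ChainComplex A ℤ} {f g : diskSum N ⟶ Y}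
    (h : ∀ i, σ N i ≫ f.f i = σ N i ≫ g.f i) : f = g := by
  ext i
  refine hom_ext_X ?_ (h i)
  rw [ι_eq, Category.assoc, Category.assoc, ← f.comm, ← g.comm, reassoc_of% h (i + 1)]

/-- `diskSum` is left adjoint to the forgetful functor to graded objects. -/
lemma exists_desc {Y : ChainComplex A ℤ} (a : ∀ i, N i ⟶ Y.X i) :
    ∃ f : diskSum N ⟶ Y, ∀ i, σ N i ≫ f.f i = a i := by
  choose f hf hf' using fun i ↦ exists_desc_X (a (i + 1) ≫ Y.d (i + 1) i) (a i)
  refine ⟨{ f := f, comm' := ?_ }, hf'⟩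
  rintro i j h
  obtain rfl : j + 1 = i := h
  rw [d_eq]
  refine hom_ext_X ?_ ?_
  · rw [reassoc_of% hf, Y.d_comp_d, Category.assoc, reassoc_of% (isShortExactSeq N (j + 1)).zero,
      comp_zero, zero_comp]
  · rw [reassoc_of% hf', Category.assoc, σ_π_assoc, hf]

lemma ι_comp_f {Y : ChainComplex A ℤ} (f : diskSum N ⟶ Y) (i : ℤ) :
    ι N i ≫ f.f i = σ N (i + 1) ≫ f.f (i + 1) ≫ Y.d (i + 1) i := by
  rw [ι_eq, Category.assoc, ← f.comm]

lemma exists_map {N' : ℤ → A} (a : ∀ i, N i ⟶ N' i) :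
    ∃ f : diskSum N ⟶ diskSum N', ∀ i,
      f.f i = (biprod.map (a (i + 1)) (a i) : N (i + 1) ⊞ N i ⟶ N' (i + 1) ⊞ N' i) := by
  obtain ⟨f, hf⟩ := exists_desc (Y := diskSum N') fun i ↦ a i ≫ σ N' i
  refine ⟨f, fun i ↦ hom_ext_X ?_ ((hf i).trans (biprod.inr_map _ _).symm)⟩
  rw [ι_comp_f, reassoc_of% hf, ← ι_eq]
  exact (biprod.inl_map _ _).symm

lemma exists_isShortExactSeq {N₁ N₂ N₃ : ℤ → A} {a : ∀ i, N₁ i ⟶ N₂ i} {b : ∀ i, N₂ i ⟶ N₃ i}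
    (h : ∀ i, IsShortExactSeq (a i) (b i)) :
    ∃ (f : diskSum N₁ ⟶ diskSum N₂) (g : diskSum N₂ ⟶ diskSum N₃), IsShortExactSeq f g ∧
      (∀ i, σ N₁ i ≫ f.f i = a i ≫ σ N₂ i) := by
  obtain ⟨f, hf⟩ := exists_map a
  obtain ⟨g, hg⟩ := exists_map b
  have hs (i : ℤ) : IsShortExactSeq (f.f i) (g.f i) := by
    rw [hf, hg]
    exact (h (i + 1)).biprod_map (h i)
  have hfg : f ≫ g = 0 := by
    ext i
    exact (hs i).zero
  refine ⟨f, g, ⟨hfg, HomologicalComplex.shortExact_of_degreewise_shortExact _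
    fun i ↦ (hs i).shortExact⟩, fun i ↦ ?_⟩
  rw [hf]
  exact biprod.inr_map _ _

lemma nonempty_iso {N N' : ℤ → A} (e : ∀ i, N i ≅ N' i) : Nonempty (diskSum N ≅ diskSum N') := by
  obtain ⟨f, hf⟩ := exists_map fun i ↦ (e i).hom
  have (i : ℤ) : IsIso (f.f i) := by
    rw [hf]
    exact (biprod.mapIso (e (i + 1)) (e i)).isIso_hom
  have := HomologicalComplex.Hom.isIso_of_components f
  exact ⟨asIso f⟩

/-- A left adjoint of a functor preserving epimorphisms preserves projectives. -/
lemma projective (h : ∀ i, Projective (N i)) : Projective (diskSum N) where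
  factors {E Y} f e _ := by
    obtain ⟨g, hg⟩ := exists_desc fun i ↦ Projective.factorThru (σ N i ≫ f.f i) (e.f i)
    refine ⟨g, hom_ext fun i ↦ ?_⟩
    rw [HomologicalComplex.comp_f, reassoc_of% hg i, Projective.factorThru_comp]

lemma exists_epi [EnoughProjectives A] (X : ChainComplex A ℤ) :
    ∃ (N : ℤ → A) (p : diskSum N ⟶ X), (∀ i, Projective (N i)) ∧ Epi p := by
  obtain ⟨p, hp⟩ := exists_desc fun i ↦ Projective.π (X.X i)
  refine ⟨_, p, fun i ↦ inferInstance, ?_⟩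
  have (i : ℤ) : Epi (p.f i) := epi_of_epi_fac (hp i)
  exact HomologicalComplex.epi_of_epi_f p this

/-- The disk sum of projective presentations of the `N i` is a projective presentation. By
adjunction, extending a map into `B` along it is a separate problem in each degree. -/
lemma subsingleton_ext [EnoughProjectives A] [HasExt.{u} A] [HasExt.{u'} (ChainComplex A ℤ)]
    {B : ChainComplex A ℤ} (h : ∀ i, Subsingleton (Ext (N i) (B.X i) 1)) :
    Subsingleton (Ext (diskSum N) B 1) := by
  have hs (i : ℤ) := IsShortExactSeq.of_epi (Projective.π (N i))
  obtain ⟨f, g, hfg, hf⟩ := exists_isShortExactSeq hs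
  have := projective (N := fun i ↦ Projective.over (N i)) fun i ↦ inferInstance
  refine hfg.subsingleton_ext_of_extension (Ext.subsingleton_of_projective _ _ _) fun φ ↦ ?_
  choose ψ hψ using fun i ↦ (hs i).exists_extension (h i) 
    (σ (fun i ↦ kernel (Projective.π (N i))) i ≫ φ.f i)
  obtain ⟨χ, hχ⟩ := exists_desc ψ
  refine ⟨χ, hom_ext fun i ↦ ?_⟩
  rw [HomologicalComplex.comp_f, reassoc_of% hf i, hχ, hψ]

/-- An acyclic complex whose cycles split off is a direct sum of disks. -/
lemma nonempty_iso_of_acyclic [HasExt.{u} A] {X : ChainComplex A ℤ} (hX : X.Acyclic)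
    (e : ∀ i, Nonempty (N (i + 1) ≅ X.cycles i))
    (h : ∀ i, Subsingleton (Ext (N i) (X.cycles i) 1)) : Nonempty (X ≅ diskSum N) := by
  have key (i : ℤ) : ∃ a : N i ⟶ X.X i, ∀ j, j + 1 = i → IsIso (a ≫ X.toCycles i j) := by
    obtain ⟨j, rfl⟩ : ∃ j, i = j + 1 := ⟨i - 1, by lia⟩
    obtain ⟨e⟩ := e j
    -- Vanishing of `Ext¹` lifts the isomorphism onto the cycles in degree `j` to a map into `X.X (j
    -- + 1)`.
    obtain ⟨a, ha⟩ := (hX.isShortExactSeq (i := j + 1) rfl).exists_section (h _) e.hom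
    refine ⟨a, fun k hk ↦ ?_⟩
    obtain rfl : k = j := by lia
    rw [ha]
    infer_instance
  choose a ha using key
  obtain ⟨f, hf⟩ := exists_desc a
  have (i : ℤ) : IsIso (f.f i) := by
    obtain ⟨j, rfl⟩ : ∃ j, i = j + 1 := ⟨i - 1, by lia⟩
    have := ha (j + 1) j rfl
    have := ha (j + 1 + 1) (j + 1) rfl
    -- Five lemma: on cycles and on the quotient, `f` induces the isomorphisms provided by `ha`.
    refine (isShortExactSeq N (j + 1)).isIso_mid (hX.isShortExactSeq rfl)
      (a := a (j + 1 + 1) ≫ X.toCycles _ (j + 1)) (c := a (j + 1) ≫ X.toCycles _ j) ?_ ?_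
    · rw [ι_comp_f, reassoc_of% hf, Category.assoc, X.toCycles_i]
    · refine hom_ext_X ?_ ?_
      · rw [reassoc_of% ι_comp_f, X.d_toCycles, comp_zero, comp_zero,
          reassoc_of% (isShortExactSeq N (j + 1)).zero, zero_comp]
      · rw [reassoc_of% hf, σ_π_assoc]
  have := HomologicalComplex.Hom.isIso_of_components f
  exact ⟨(asIso f).symm⟩

end diskSum

end DiskSums

/-! ### Reflexivity with respect to `C`, and Hom into `C ⊗ F` -/

section LinearAlgebra

open TensorProduct

variable {R : Type*} [CommRing R] (C : Type*) [AddCommGroup C] [Module R C]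

/-- The biduality map `M → Hom(Hom(M, C), C)` is bijective. -/
structure IsReflexiveModule (M : Type*) [AddCommGroup M] [Module R M] : Prop where
  eq_zero : ∀ x : M, (∀ φ : M →ₗ[R] C, φ x = 0) → x = 0
  exists_eq : ∀ ψ : (M →ₗ[R] C) →ₗ[R] C, ∃ x : M, ∀ φ, ψ φ = φ x

variable {C}
variable {K P M : Type*} [AddCommGroup K] [AddCommGroup P] [AddCommGroup M] [Module R K]
  [Module R P] [Module R M]

lemma IsReflexiveModule.of_equiv (h : IsReflexiveModule (R := R) C M) (e : M ≃ₗ[R] K) :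
    IsReflexiveModule (R := R) C K where
  eq_zero x hx := e.symm.map_eq_zero_iff.1 (h.eq_zero _ fun φ ↦ by
    simpa using hx (φ ∘ₗ e.symm.toLinearMap))
  exists_eq ψ := by
    obtain ⟨x, hx⟩ := h.exists_eq (ψ ∘ₗ LinearMap.lcomp R C e.symm.toLinearMap)
    refine ⟨e x, fun φ ↦ ?_⟩
    have := hx (φ ∘ₗ e.toLinearMap)
    rwa [LinearMap.comp_apply, LinearMap.lcomp_apply', LinearMap.comp_assoc, e.comp_symm,
      LinearMap.comp_id] at this

/-- Kernels of epimorphisms from reflexive modules to reflexive modules are reflexive, provided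
maps to `C` extend. -/
lemma IsReflexiveModule.of_exact (hP : IsReflexiveModule (R := R) C P)
    (hM : IsReflexiveModule (R := R) C M) {i : K →ₗ[R] P} {p : P →ₗ[R] M}
    (hi : Function.Injective i) (hip : Function.Exact i p)
    (hext : ∀ φ : K →ₗ[R] C, ∃ φ' : P →ₗ[R] C, φ' ∘ₗ i = φ) :
    IsReflexiveModule (R := R) C K where
  eq_zero x hx := hi (by
    rw [map_zero]
    exact hP.eq_zero _ fun φ ↦ hx (φ ∘ₗ i))
  exists_eq ψ := by
    obtain ⟨y, hy⟩ := hP.exists_eq (ψ ∘ₗ LinearMap.lcomp R C i)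
    obtain ⟨x, rfl⟩ := (hip y).1 (hM.eq_zero _ fun φ ↦ by
      rw [← LinearMap.comp_apply, ← hy, LinearMap.comp_apply, LinearMap.lcomp_apply',
        LinearMap.comp_assoc, hip.linearMap_comp_eq_zero, LinearMap.comp_zero, map_zero])
    refine ⟨x, fun φ ↦ ?_⟩
    obtain ⟨φ', rfl⟩ := hext φ
    exact hy φ'

/-- Every endomorphism of `C` is a scalar, so `ψ` is evaluation at the element `ψ LinearMap.id`. -/
lemma IsReflexiveModule.self
    (hC : Function.Bijective (LinearMap.lsmul R C : R → (C →ₗ[R] C))) :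
    IsReflexiveModule (R := R) C C where
  eq_zero x hx := hx LinearMap.id
  exists_eq ψ := by
    refine ⟨ψ LinearMap.id, fun φ ↦ ?_⟩
    obtain ⟨r, rfl⟩ := hC.2 φ
    have : (LinearMap.lsmul R C r : C →ₗ[R] C) = r • LinearMap.id := by ext; simp
    rw [this, map_smul]
    simp

/-- `P` is a retract of some `R ^ n`, and `R` is reflexive because `R → Hom(C, C)` is bijective. The
proof spells this out in coordinates. -/
lemma IsReflexiveModule.of_projective [Module.Finite R P] [Module.Projective R P]
    (hC : Function.Bijective (LinearMap.lsmul R C : R → (C →ₗ[R] C))) :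
    IsReflexiveModule (R := R) C P := by
  obtain ⟨n, f, g, -, -, hfg⟩ := Module.Finite.exists_comp_eq_id_of_projective R P
  have hfg' (x : P) : x = ∑ k, (g x k) • f (Pi.single k 1) := by
    conv_lhs => rw [← LinearMap.id_apply (R := R) x, ← hfg, LinearMap.comp_apply,
      pi_eq_sum_univ' (g x)]
    simp [map_sum]
  refine ⟨fun x hx ↦ ?_, fun ψ ↦ ?_⟩
  · have (k : Fin n) : g x k = 0 := by
      refine hC.1 (LinearMap.ext fun c ↦ ?_)
      simpa using hx ((LinearMap.toSpanSingleton R C c) ∘ₗ LinearMap.proj k ∘ₗ g)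
    rw [hfg' x]
    simp [this]
  -- Along the `k`-th coordinate, `ψ` restricts to an endomorphism of `C`, which is multiplication
  -- by a scalar `r k`.
  · choose r hr using fun k : Fin n ↦ hC.2
      (ψ ∘ₗ LinearMap.lcomp R C (LinearMap.proj k ∘ₗ g) ∘ₗ
        (LinearMap.ringLmapEquivSelf R R C).symm.toLinearMap)
    refine ⟨∑ k, r k • f (Pi.single k 1), fun φ ↦ ?_⟩
    have hφ : φ = ∑ k, LinearMap.lcomp R C (LinearMap.proj k ∘ₗ g)
        ((LinearMap.ringLmapEquivSelf R R C).symm (φ (f (Pi.single k 1)))) := by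
      ext x
      conv_lhs => rw [hfg' x]
      simp [map_sum]
    conv_lhs => rw [hφ]
    rw [map_sum, map_sum]
    refine Finset.sum_congr rfl fun k _ ↦ ?_
    have := LinearMap.congr_fun (hr k) (φ (f (Pi.single k 1)))
    rw [map_smul]
    exact this.symm

lemma rTensorHomToHomRTensor_lcomp (F : Type*) [AddCommGroup F] [Module R F] (f : K →ₗ[R] M)
    (t : (M →ₗ[R] C) ⊗[R] F) :
    rTensorHomToHomRTensor (RingHom.id R) K C F ((LinearMap.lcomp R C f).rTensor F t) =
      rTensorHomToHomRTensor (RingHom.id R) M C F t ∘ₗ f := by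
  induction t with
  | zero => simp
  | tmul φ x => ext; simp
  | add s t hs ht => rw [map_add, map_add, hs, ht, map_add, LinearMap.add_comp]

/-- For `M` finitely presented and `F` flat, the canonical map
`Hom(M, C) ⊗ F → Hom(M, C ⊗ F)` is surjective. -/
lemma rTensorHomToHomRTensor_surjective (F : Type*) [AddCommGroup F] [Module R F] [Module.Flat R F]
    [Module.FinitePresentation R M] :
    Function.Surjective (rTensorHomToHomRTensor (RingHom.id R) M C F) := by
  intro φ
  obtain ⟨n, m, f, g, hf, hgf⟩ := Module.FinitePresentation.exists_fin' R M
  have hexact : Function.Exact (LinearMap.lcomp R C f) (LinearMap.lcomp R C g) :=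
    LinearMap.exact_lcomp_of_exact_of_surjective C hgf hf
  have hbij (k : ℕ) :
      Function.Bijective (rTensorHomToHomRTensor (RingHom.id R) (Fin k → R) C F) := by
    rw [← LinearMap.coe_coe, ← rTensorHomEquivHomRTensor_toLinearMap]
    exact (rTensorHomEquivHomRTensor R (Fin k → R) C F).bijective
  -- Diagram chase: flatness of `F` keeps `0 → Hom(M, C) → Hom(R ^ n, C) → Hom(R ^ m, C)` exact
  -- after tensoring, and over the free modules the canonical map is bijective.
  obtain ⟨t, ht⟩ := (hbij n).2 (φ ∘ₗ f)
  obtain ⟨s, rfl⟩ := (Module.Flat.rTensor_exact F hexact t).1 <| (hbij m).1 <| by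
    rw [rTensorHomToHomRTensor_lcomp, ht, map_zero, LinearMap.comp_assoc,
      hgf.linearMap_comp_eq_zero, LinearMap.comp_zero]
  refine ⟨s, ?_⟩
  rw [rTensorHomToHomRTensor_lcomp] at ht
  exact (LinearMap.cancel_right hf).1 ht

/-- By finite presentation of `K`, the map `φ` comes from `Hom(K, C) ⊗ F`, and tensoring with `F`
preserves surjectivity of the restriction `Hom(P, C) → Hom(K, C)`. -/
lemma exists_extension_tensor (F : Type*) [AddCommGroup F] [Module R F] [Module.Flat R F]
    [Module.FinitePresentation R K] {i : K →ₗ[R] P}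
    (hext : ∀ φ : K →ₗ[R] C, ∃ φ' : P →ₗ[R] C, φ' ∘ₗ i = φ) (φ : K →ₗ[R] C ⊗[R] F) :
    ∃ φ' : P →ₗ[R] C ⊗[R] F, φ' ∘ₗ i = φ := by
  obtain ⟨t, rfl⟩ := rTensorHomToHomRTensor_surjective F φ
  obtain ⟨s, rfl⟩ := LinearMap.rTensor_surjective F (g := LinearMap.lcomp R C i) hext t
  exact ⟨_, (rTensorHomToHomRTensor_lcomp F i s).symm⟩

end LinearAlgebra

/-! ### Syzygies of a projective resolution -/

section Resolutions

variable {A : Type w} [Category.{v} A] [Abelian A] {Z : A} (P : ProjectiveResolution Z)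

/-- The syzygies of a projective resolution. -/
lemma CategoryTheory.ProjectiveResolution.isShortExactSeq (n : ℕ) :
    IsShortExactSeq (P.complex.fromOpcycles (n + 1) n) (P.complex.pOpcycles n) := by
  have hn : (ComplexShape.down ℕ).next (n + 1) = n := by simp
  have hn' : (ComplexShape.down ℕ).prev n = n + 1 := by simp
  have hz : P.complex.fromOpcycles (n + 1) n ≫ P.complex.pOpcycles n = 0 := by
    rw [← cancel_epi (P.complex.pOpcycles (n + 1)), P.complex.p_fromOpcycles_assoc,
      P.complex.d_pOpcycles, comp_zero]
  refine ⟨hz, { exact := ?_, mono_f := ?_, epi_g := inferInstanceAs (Epi (P.complex.pOpcycles n)) }⟩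
  · let φ : ShortComplex.mk _ _ (P.complex.d_pOpcycles (n + 1) n) ⟶ ShortComplex.mk _ _ hz :=
      { τ₁ := P.complex.pOpcycles (n + 1), τ₂ := 𝟙 _, τ₃ := 𝟙 _ }
    have : Epi φ.τ₁ := inferInstanceAs (Epi (P.complex.pOpcycles (n + 1)))
    have : IsIso φ.τ₂ := inferInstanceAs (IsIso (𝟙 _))
    have : Mono φ.τ₃ := inferInstanceAs (Mono (𝟙 _))
    exact (ShortComplex.exact_iff_of_epi_of_isIso_of_mono φ).1
      (ShortComplex.exact_of_g_is_cokernel _ (P.complex.opcyclesIsCokernel (n + 1) n hn'))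
  · change Mono (P.complex.fromOpcycles (n + 1) n)
    rw [Preadditive.mono_iff_cancel_zero]
    intro T f hf
    obtain ⟨g, rfl⟩ := KernelFork.IsLimit.lift' (P.complex.homologyIsKernel (n + 1) n hn) f hf
    exact (zero_comp (f := P.complex.homologyι (n + 1))) ▸
      congrArg (· ≫ P.complex.homologyι (n + 1))
        ((P.complex_exactAt_succ n).isZero_homology.eq_of_tgt g 0)

lemma CategoryTheory.ProjectiveResolution.nonempty_opcycles_iso :
    Nonempty (P.complex.opcycles 0 ≅ Z) :=
  ⟨IsColimit.coconePointUniqueUpToIso (P.complex.opcyclesIsCokernel 1 0 (by simp))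
    P.isColimitCokernelCofork⟩

end Resolutions

/-! ### Syzygies of a semidualizing module and their `C`-duals -/

section Modules

open CategoryTheory.Abelian TensorProduct

lemma Module.FinitePresentation.tensorProduct {R : Type*} [CommRing R] (P M : Type*)
    [AddCommGroup P] [Module R P] [AddCommGroup M] [Module R M] [Module.Projective R P]
    [Module.Finite R P] [Module.FinitePresentation R M] :
    Module.FinitePresentation R (P ⊗[R] M) := by
  obtain ⟨n, m, f, g, hf, hgf⟩ := Module.FinitePresentation.exists_fin' R M
  have := Module.finitePresentation_of_projective R (P ⊗[R] (Fin n → R))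
  refine Module.finitePresentation_of_surjective _ (LinearMap.lTensor_surjective P hf) ?_
  rw [(lTensor_exact P hgf hf).linearMap_ker_eq, ← Submodule.map_top]
  exact Module.Finite.fg_top.map _

variable {R : Type u} [CommRing R]

lemma ModuleCat.isShortExactSeq_iff {X Y Z : ModuleCat.{u} R} {i : X ⟶ Y} {p : Y ⟶ Z} :
    IsShortExactSeq i p ↔ Function.Injective i.hom ∧ Function.Exact i.hom p.hom ∧
      Function.Surjective p.hom := by
  constructor
  · intro h
    exact ⟨h.shortExact.moduleCat_injective_f,
      (ShortComplex.ShortExact.moduleCat_exact_iff_function_exact _).1 h.shortExact.exact,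
      h.shortExact.moduleCat_surjective_g⟩
  · rintro ⟨hi, h, hp⟩
    have hz : i ≫ p = 0 := ModuleCat.hom_ext h.linearMap_comp_eq_zero
    exact ⟨hz, ModuleCat.shortComplex_shortExact (ShortComplex.mk i p hz) h hi hp⟩

lemma IsShortExactSeq.tensor {X Y Z : ModuleCat.{u} R} {i : X ⟶ Y} {p : Y ⟶ Z}
    (h : IsShortExactSeq i p) (P : ModuleCat.{u} R) [Module.Flat R P] :
    IsShortExactSeq (ModuleCat.ofHom (i.hom.rTensor P)) (ModuleCat.ofHom (p.hom.rTensor P)) := by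
  obtain ⟨hi, hip, hp⟩ := ModuleCat.isShortExactSeq_iff.1 h
  exact ModuleCat.isShortExactSeq_iff.2 ⟨Module.Flat.rTensor_preserves_injective_linearMap _ hi,
    rTensor_exact P hip hp, LinearMap.rTensor_surjective P hp⟩

lemma projective_of_projectiveModules {P : ModuleCat.{u} R} (h : Module.Projective R P) :
    Projective P :=
  (IsProjective.iff_projective (R := R) P).1 h

lemma projectiveModules_of_projective (P : ModuleCat.{u} R) [h : Projective P] :
    Module.Projective R P :=
  (IsProjective.iff_projective (R := R) P).2 h

/-- Vanishing of `Ext¹(N, B)` implies vanishing of `Ext¹(N ⊗ P, B)` for `P` projective. -/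
lemma subsingleton_ext_tensor {N B : ModuleCat.{u} R} (h : Subsingleton (Ext N B 1))
    (P : ModuleCat.{u} R) [Module.Projective R P] :
    Subsingleton (Ext (ModuleCat.of R (N ⊗[R] P)) B 1) := by
  have hs := IsShortExactSeq.of_epi (Projective.π N)
  have hG := projectiveModules_of_projective (Projective.over N)
  have : Projective (ModuleCat.of R (↑(Projective.over N) ⊗[R] P)) :=
    projective_of_projectiveModules
      (inferInstanceAs (Module.Projective R (↑(Projective.over N) ⊗[R] P)))
  refine (hs.tensor P).subsingleton_ext_of_extension (Ext.subsingleton_of_projective _ _ _)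
    fun f ↦ ?_
  have hsurj : Function.Surjective (LinearMap.lcomp R B (kernel.ι (Projective.π N)).hom) := by
    intro φ
    obtain ⟨g, hg⟩ := hs.exists_extension h (ModuleCat.ofHom φ)
    exact ⟨g.hom, congr(ModuleCat.Hom.hom $hg)⟩
  -- By adjunction `f` is a map from `P` to `Hom(kernel, B)`; projectivity of `P` lifts it along the
  -- surjective restriction map.
  obtain ⟨g, hg⟩ := Module.projective_lifting_property _ (TensorProduct.curry f.hom).flip hsurj
  refine ⟨ModuleCat.ofHom (TensorProduct.lift g.flip), ModuleCat.hom_ext ?_⟩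
  refine TensorProduct.ext' fun x y ↦ ?_
  exact LinearMap.congr_fun (LinearMap.congr_fun hg y) x

lemma cProjectiveModules_of_iso {C M M' : ModuleCat.{u} R} (e : M ≅ M')
    (h : cProjectiveModules C M) : cProjectiveModules C M' := by
  obtain ⟨P, hP, ⟨e'⟩⟩ := h
  exact ⟨P, hP, ⟨e.symm ≪≫ e'⟩⟩

lemma cProjectiveModules_tensor {C M : ModuleCat.{u} R} (h : cProjectiveModules C M)
    (P : ModuleCat.{u} R) [Module.Projective R P] :
    cProjectiveModules C (ModuleCat.of R (M ⊗[R] P)) := by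
  obtain ⟨Q, hQ, ⟨e⟩⟩ := h
  exact ⟨ModuleCat.of R (Q ⊗[R] P), inferInstanceAs (Module.Projective R (Q ⊗[R] P)),
    ⟨(TensorProduct.congr e.toLinearEquiv (LinearEquiv.refl R P) ≪≫ₗ
      TensorProduct.assoc R C Q P).toModuleIso⟩⟩

lemma cProjectiveModules_hom (C P : ModuleCat.{u} R) [Module.Projective R P] [Module.Finite R P] :
    cProjectiveModules C (ModuleCat.of R (P →ₗ[R] C)) :=
  ⟨ModuleCat.of R (Module.Dual R P), inferInstanceAs (Module.Projective R (Module.Dual R P)),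
    ⟨((dualTensorHomEquiv R P C).symm ≪≫ₗ TensorProduct.comm R _ _).toModuleIso⟩⟩

lemma cProjectiveModules_self (C : ModuleCat.{u} R) : cProjectiveModules C C :=
  ⟨ModuleCat.of R R, inferInstanceAs (Module.Projective R R),
    ⟨(TensorProduct.rid R C).symm.toModuleIso⟩⟩

namespace IsSemidualizing

variable {C : ModuleCat.{u} R} (hC : IsSemidualizing C)

include hC in
/-- The modules `Ω n` are the syzygies of `C`. -/
lemma exists_syzygies : ∃ (Ω P : ℕ → ModuleCat.{u} R) (i : ∀ n, Ω (n + 1) ⟶ P n)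
    (p : ∀ n, P n ⟶ Ω n), Nonempty (Ω 0 ≅ C) ∧ (∀ n, IsShortExactSeq (i n) (p n)) ∧
      (∀ n, Module.Projective R (P n)) ∧ (∀ n, Module.Finite R (P n)) := by
  obtain ⟨P, hP⟩ := hC.exists_resolution
  exact ⟨fun n ↦ P.complex.opcycles n, P.complex.X, _, _, P.nonempty_opcycles_iso, P.isShortExactSeq,
    fun n ↦ projectiveModules_of_projective _, hP⟩

section

variable {Ω P : ℕ → ModuleCat.{u} R} {i : ∀ n, Ω (n + 1) ⟶ P n} {p : ∀ n, P n ⟶ Ω n}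
  (e : Ω 0 ≅ C) (h : ∀ n, IsShortExactSeq (i n) (p n)) [hP : ∀ n, Module.Projective R (P n)]
  [hP' : ∀ n, Module.Finite R (P n)]

include h

omit hP in
lemma finite_syzygy (n : ℕ) : Module.Finite R (Ω n) :=
  Module.Finite.of_surjective (p n).hom (ModuleCat.isShortExactSeq_iff.1 (h n)).2.2

lemma finitePresentation_syzygy (n : ℕ) : Module.FinitePresentation R (Ω n) := by
  obtain ⟨-, hip, hp⟩ := ModuleCat.isShortExactSeq_iff.1 (h n)
  have := finite_syzygy h (n + 1)
  have := Module.finitePresentation_of_projective R (P n)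
  refine Module.finitePresentation_of_surjective (p n).hom hp ?_
  rw [hip.linearMap_ker_eq, ← Submodule.map_top]
  exact Module.Finite.fg_top.map _

include hC e

omit hP' in
lemma subsingleton_ext_syzygy (n : ℕ) : Subsingleton (Ext (Ω n) C 1) := by
  -- Each passage to the next syzygy lowers the degree by one, so the induction needs all positive
  -- degrees.
  suffices ∀ k, Subsingleton (Ext (Ω n) C (k + 1)) from this 0
  induction n with
  | zero => exact fun k ↦ subsingleton_ext_of_iso e.symm (hC.ext_eq_zero _ (by lia))
  | succ n ih =>
    intro k
    have := projective_of_projectiveModules (hP n)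
    exact (h n).subsingleton_ext_left (Ext.subsingleton_of_projective _ _ _) (ih (k + 1))

omit hP' in
lemma exists_extension_syzygy (n : ℕ) (φ : Ω (n + 1) →ₗ[R] C) :
    ∃ φ' : P n →ₗ[R] C, φ' ∘ₗ (i n).hom = φ := by
  obtain ⟨g, hg⟩ := (h n).exists_extension (hC.subsingleton_ext_syzygy e h n) (ModuleCat.ofHom φ)
  exact ⟨g.hom, congr(ModuleCat.Hom.hom $hg)⟩

lemma subsingleton_ext_syzygy_tensor (F : ModuleCat.{u} R) [Module.Flat R F] (n : ℕ) :
    Subsingleton (Ext (Ω n) (ModuleCat.of R (C ⊗[R] F)) 1) := by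
  have := projective_of_projectiveModules (hP n)
  have := finitePresentation_syzygy h (n + 1)
  refine (h n).subsingleton_ext_of_extension (Ext.subsingleton_of_projective _ _ _) fun f ↦ ?_
  obtain ⟨g, hg⟩ := exists_extension_tensor F (hC.exists_extension_syzygy e h n) f.hom
  exact ⟨ModuleCat.ofHom g, ModuleCat.hom_ext hg⟩

/-- Reflexivity starts at `C` and descends to kernels, since `Ext¹(Ω n, C) = 0` lets maps from `Ω (n
+ 1)` to `C` extend. -/
lemma isReflexiveModule_syzygy (n : ℕ) : IsReflexiveModule (R := R) C (Ω n) := by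
  induction n with
  | zero => exact (IsReflexiveModule.self hC.homothety_bijective).of_equiv e.symm.toLinearEquiv
  | succ n ih =>
    obtain ⟨hi, hip, -⟩ := ModuleCat.isShortExactSeq_iff.1 (h n)
    exact (IsReflexiveModule.of_projective hC.homothety_bijective).of_exact ih hi hip
      (hC.exists_extension_syzygy e h n)

omit hP' in
lemma isShortExactSeq_dual (n : ℕ) :
    IsShortExactSeq (X := ModuleCat.of R (Ω n →ₗ[R] C)) (Y := ModuleCat.of R (P n →ₗ[R] C))
      (Z := ModuleCat.of R (Ω (n + 1) →ₗ[R] C)) (ModuleCat.ofHom (LinearMap.lcomp R C (p n).hom))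
      (ModuleCat.ofHom (LinearMap.lcomp R C (i n).hom)) := by
  obtain ⟨hi, hip, hp⟩ := ModuleCat.isShortExactSeq_iff.1 (h n)
  exact ModuleCat.isShortExactSeq_iff.2 ⟨LinearMap.lcomp_injective_of_surjective _ hp,
    LinearMap.exact_lcomp_of_exact_of_surjective C hip hp, hC.exists_extension_syzygy e h n⟩

/-- By reflexivity `ψ` is evaluation at some `x` in `Ω n`; evaluation at a preimage of `x` in `P n`
extends it. -/
lemma exists_extension_dual (n : ℕ) (ψ : (Ω n →ₗ[R] C) →ₗ[R] C) :
    ∃ ψ' : (P n →ₗ[R] C) →ₗ[R] C, ψ' ∘ₗ LinearMap.lcomp R C (p n).hom = ψ := by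
  obtain ⟨x, hx⟩ := (hC.isReflexiveModule_syzygy e h n).exists_eq ψ
  obtain ⟨y, rfl⟩ := (ModuleCat.isShortExactSeq_iff.1 (h n)).2.2 x
  exact ⟨LinearMap.applyₗ y, LinearMap.ext fun φ ↦ (hx φ).symm⟩

omit h hP hP' in
lemma nonempty_dual_zero_iso : Nonempty (ModuleCat.of R (Ω 0 →ₗ[R] C) ≅ ModuleCat.of R R) :=
  ⟨(LinearEquiv.congrLeft C R e.toLinearEquiv ≪≫ₗ
    (LinearEquiv.ofBijective _ hC.homothety_bijective).symm).toModuleIso⟩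

/-- The induction starts at `Hom(C, C) ≅ R` and follows the dualized sequences. Both claims are
proved together because extending maps into `C ⊗ F` at stage `n + 1` requires finite presentation at
stage `n`. -/
lemma dual_syzygy (n : ℕ) : Module.FinitePresentation R (Ω n →ₗ[R] C) ∧
    ∀ (F : ModuleCat.{u} R) [Module.Flat R F],
      Subsingleton (Ext (ModuleCat.of R (Ω n →ₗ[R] C)) (ModuleCat.of R (C ⊗[R] F)) 1) := by
  induction n with
  | zero =>
    obtain ⟨e'⟩ := hC.nonempty_dual_zero_iso e
    refine ⟨.of_equiv e'.symm.toLinearEquiv, fun F _ ↦ subsingleton_ext_of_iso e'.symm ?_⟩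
    have : Projective (ModuleCat.of R R) :=
      projective_of_projectiveModules (inferInstanceAs (Module.Projective R R))
    exact Ext.subsingleton_of_projective _ _ _
  | succ n ih =>
    obtain ⟨ih, ih'⟩ := ih
    have hs := hC.isShortExactSeq_dual e h n
    obtain ⟨-, hip, hp⟩ := ModuleCat.isShortExactSeq_iff.1 hs
    refine ⟨?_, fun F _ ↦ ?_⟩
    · have : Module.FinitePresentation R (P n →ₗ[R] C) := by
        have := finitePresentation_syzygy h 0
        have := Module.FinitePresentation.of_equiv e.toLinearEquiv
        have := Module.FinitePresentation.tensorProduct (R := R) (Module.Dual R (P n)) C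
        exact .of_equiv (M := Module.Dual R (P n) ⊗[R] C) (dualTensorHomEquiv R (P n) C)
      refine Module.finitePresentation_of_surjective _ hp ?_
      rw [hip.linearMap_ker_eq, ← Submodule.map_top]
      exact Module.Finite.fg_top.map _
    · refine hs.subsingleton_ext_of_extension ?_ fun f ↦ ?_
      · obtain ⟨Q, hQ, ⟨e'⟩⟩ := cProjectiveModules_hom C (P n)
        exact subsingleton_ext_of_iso e'.symm (subsingleton_ext_tensor
          (subsingleton_ext_of_iso e (hC.subsingleton_ext_syzygy_tensor e h F 0)) Q)
      · obtain ⟨g, hg⟩ := exists_extension_tensor F (hC.exists_extension_dual e h n) f.hom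
        exact ⟨ModuleCat.ofHom g, ModuleCat.hom_ext hg⟩

end

include hC in
/-- The class of syzygies of `C` and of their `C`-duals. -/
lemma exists_syzygy_class : ∃ 𝒩 : ObjectProperty (ModuleCat.{u} R), 𝒩 C ∧
    (∀ N, 𝒩 N → ∀ (F : ModuleCat.{u} R) [Module.Flat R F],
      Subsingleton (Ext N (ModuleCat.of R (C ⊗[R] F)) 1)) ∧
    (∀ N, 𝒩 N → ∃ (N' W : ModuleCat.{u} R) (i : N' ⟶ W) (p : W ⟶ N), IsShortExactSeq i p ∧
      𝒩 N' ∧ (projectiveModules R W ∨ cProjectiveModules C W)) ∧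
    (∀ N, 𝒩 N → ∃ (W N' : ModuleCat.{u} R) (i : N ⟶ W) (p : W ⟶ N'), IsShortExactSeq i p ∧
      𝒩 N' ∧ (projectiveModules R W ∨ cProjectiveModules C W)) ∧
    (∃ (Q N : ModuleCat.{u} R) (i : ModuleCat.of R R ⟶ Q) (p : Q ⟶ N), IsShortExactSeq i p ∧
      𝒩 N ∧ cProjectiveModules C Q) ∧
    (∃ (N P : ModuleCat.{u} R) (i : N ⟶ P) (p : P ⟶ C), IsShortExactSeq i p ∧
      𝒩 N ∧ projectiveModules R P) := by
  obtain ⟨Ω, P, i, p, ⟨e⟩, h, hP, hP'⟩ := hC.exists_syzygies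
  obtain ⟨e'⟩ := hC.nonempty_dual_zero_iso e
  have hR : projectiveModules R (ModuleCat.of R R) := inferInstanceAs (Module.Projective R R)
  have h₀ : IsZero (ModuleCat.of R PUnit.{u + 1}) := ModuleCat.isZero_of_subsingleton _
  -- Zero is included so that the two families can stop: to the right of `C` comes `C = C ⟶ 0`, and
  -- to the left of `Hom(C, C) ≅ R` comes `0 ⟶ R = R`.
  refine ⟨fun N ↦ (∃ n, Nonempty (N ≅ Ω n)) ∨
    (∃ n, Nonempty (N ≅ ModuleCat.of R (Ω n →ₗ[R] C))) ∨ IsZero N, Or.inl ⟨0, ⟨e.symm⟩⟩,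
    ?_, ?_, ?_, ?_, ?_⟩
  · rintro N (⟨n, ⟨f⟩⟩ | ⟨n, ⟨f⟩⟩ | hN) F _
    · exact subsingleton_ext_of_iso f.symm (hC.subsingleton_ext_syzygy_tensor e h F n)
    · exact subsingleton_ext_of_iso f.symm ((hC.dual_syzygy e h n).2 F)
    · have : Projective N := Projective.of_iso (hN.iso (isZero_zero _)).symm inferInstance
      exact Ext.subsingleton_of_projective _ _ _
  · rintro N (⟨n, ⟨f⟩⟩ | ⟨n | n, ⟨f⟩⟩ | hN)
    · exact ⟨_, _, _, _, (h n).postcomp_iso f.symm, Or.inl ⟨n + 1, ⟨Iso.refl _⟩⟩, Or.inl (hP n)⟩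
    · exact ⟨_, _, _, _, .of_zero_iso (f ≪≫ e').inv h₀, Or.inr (Or.inr h₀), Or.inl hR⟩
    · exact ⟨_, _, _, _, (hC.isShortExactSeq_dual e h n).postcomp_iso f.symm,
        Or.inr (Or.inl ⟨n, ⟨Iso.refl _⟩⟩), Or.inr (cProjectiveModules_hom C (P n))⟩
    · exact ⟨_, _, _, _, .of_zero_iso (hN.iso h₀).inv h₀, Or.inr (Or.inr h₀),
        Or.inl (inferInstanceAs (Module.Projective R PUnit.{u + 1}))⟩
  · rintro N (⟨n | n, ⟨f⟩⟩ | ⟨n, ⟨f⟩⟩ | hN)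
    · exact ⟨_, _, _, _, .of_iso_zero (f ≪≫ e).hom h₀, Or.inr (Or.inr h₀),
        Or.inr (cProjectiveModules_self C)⟩
    · exact ⟨_, _, _, _, (h n).precomp_iso f, Or.inl ⟨n, ⟨Iso.refl _⟩⟩, Or.inl (hP n)⟩
    · exact ⟨_, _, _, _, (hC.isShortExactSeq_dual e h n).precomp_iso f,
        Or.inr (Or.inl ⟨n + 1, ⟨Iso.refl _⟩⟩), Or.inr (cProjectiveModules_hom C (P n))⟩
    · exact ⟨_, _, _, _, .of_iso_zero (hN.iso h₀).hom h₀, Or.inr (Or.inr h₀),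
        Or.inl (inferInstanceAs (Module.Projective R PUnit.{u + 1}))⟩
  · exact ⟨_, _, _, _, (hC.isShortExactSeq_dual e h 0).precomp_iso e'.symm,
      Or.inr (Or.inl ⟨1, ⟨Iso.refl _⟩⟩), cProjectiveModules_hom C (P 0)⟩
  · exact ⟨_, _, _, _, (h 0).postcomp_iso e, Or.inl ⟨1, ⟨Iso.refl _⟩⟩, hP 0⟩

end IsSemidualizing

end Modules

/-! ### Projective and `C`-projective complexes as disk sums, and the main theorem -/

section ComplexesOf

open CategoryTheory.Abelian TensorProduct

lemma diskSum.nonempty_biprod_iso {A : Type w} [Category.{v} A] [Abelian A] (N N' : ℤ → A) :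
    Nonempty (diskSum N ⊞ diskSum N' ≅ diskSum fun i ↦ N i ⊞ N' i) := by
  obtain ⟨f₁, hf₁⟩ := exists_desc (Y := diskSum N) fun i ↦ (biprod.fst : N i ⊞ N' i ⟶ _) ≫ σ N i
  obtain ⟨f₂, hf₂⟩ := exists_desc (Y := diskSum N') fun i ↦ (biprod.snd : N i ⊞ N' i ⟶ _) ≫ σ N' i
  obtain ⟨g₁, hg₁⟩ := exists_desc (Y := diskSum fun i ↦ N i ⊞ N' i) (N := N)
    fun i ↦ (biprod.inl : _ ⟶ N i ⊞ N' i) ≫ σ (fun i ↦ N i ⊞ N' i) i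
  obtain ⟨g₂, hg₂⟩ := exists_desc (Y := diskSum fun i ↦ N i ⊞ N' i) (N := N')
    fun i ↦ (biprod.inr : _ ⟶ N i ⊞ N' i) ≫ σ (fun i ↦ N i ⊞ N' i) i
  refine ⟨⟨biprod.desc g₁ g₂, biprod.lift f₁ f₂, ?_, ?_⟩⟩
  · have h₁₁ : g₁ ≫ f₁ = 𝟙 _ := hom_ext fun i ↦ by simp [reassoc_of% hg₁, hf₁]
    have h₁₂ : g₁ ≫ f₂ = 0 := hom_ext fun i ↦ by simp [reassoc_of% hg₁, hf₂]
    have h₂₁ : g₂ ≫ f₁ = 0 := hom_ext fun i ↦ by simp [reassoc_of% hg₂, hf₁]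
    have h₂₂ : g₂ ≫ f₂ = 𝟙 _ := hom_ext fun i ↦ by simp [reassoc_of% hg₂, hf₂]
    apply biprod.hom_ext' <;> apply biprod.hom_ext <;> simp [h₁₁, h₁₂, h₂₁, h₂₂]
  · rw [biprod.lift_desc]
    refine hom_ext fun i ↦ ?_
    rw [HomologicalComplex.add_f_apply, Preadditive.comp_add, HomologicalComplex.comp_f,
      HomologicalComplex.comp_f, reassoc_of% hf₁, reassoc_of% hf₂, hg₁, hg₂, ← Category.assoc,
      ← Category.assoc, ← Preadditive.add_comp, biprod.total, HomologicalComplex.id_f,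
      Category.id_comp, Category.comp_id]

variable {R : Type u} [CommRing R]

lemma complexesOf_of_iso {𝒳 : ObjectProperty (ModuleCat.{u} R)} [𝒳.IsClosedUnderIsomorphisms]
    {X Y : ChainComplex (ModuleCat.{u} R) ℤ} (e : X ≅ Y) (hX : complexesOf 𝒳 X) :
    complexesOf 𝒳 Y :=
  ⟨fun i ↦ (hX.1 i).of_iso e,
    fun i ↦ 𝒳.prop_of_iso ((HomologicalComplex.cyclesFunctor _ _ i).mapIso e) (hX.2 i)⟩

lemma complexesOf_diskSum {𝒳 : ObjectProperty (ModuleCat.{u} R)} [𝒳.IsClosedUnderIsomorphisms]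
    {N : ℤ → ModuleCat.{u} R} (hN : ∀ i, 𝒳 (N i)) : complexesOf 𝒳 (diskSum N) :=
  ⟨diskSum.acyclic N, fun i ↦ by
    obtain ⟨e⟩ := diskSum.nonempty_iso_cycles N i
    exact 𝒳.prop_of_iso e (hN _)⟩

/-- If `Ext¹` vanishes between modules in `𝒳`, the `𝒳`-complexes are direct sums of disks. -/
lemma exists_diskSum_iso {𝒳 : ObjectProperty (ModuleCat.{u} R)}
    (h : ∀ M N, 𝒳 M → 𝒳 N → Subsingleton (Ext M N 1)) {X : ChainComplex (ModuleCat.{u} R) ℤ}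
    (hX : complexesOf 𝒳 X) : ∃ N : ℤ → ModuleCat.{u} R, (∀ i, 𝒳 (N i)) ∧
      Nonempty (X ≅ diskSum N) := by
  -- The shift is forced: the cycles of `diskSum N` in degree `i` are `N (i + 1)`.
  refine ⟨fun i ↦ X.cycles (i - 1), fun i ↦ hX.2 _, diskSum.nonempty_iso_of_acyclic hX.1
    (fun i ↦ ?_) fun i ↦ h _ _ (hX.2 _) (hX.2 _)⟩
  rw [show i + 1 - 1 = i by lia]
  exact ⟨Iso.refl _⟩

instance : (projectiveModules R).IsClosedUnderIsomorphisms where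
  of_iso {M N} e h := by
    have : Module.Projective R M := h
    exact Module.Projective.of_equiv e.toLinearEquiv

instance (C : ModuleCat.{u} R) : (cProjectiveModules C).IsClosedUnderIsomorphisms where
  of_iso e h := cProjectiveModules_of_iso e h

lemma cProjectiveModules_biprod {C M M' : ModuleCat.{u} R} (h : cProjectiveModules C M)
    (h' : cProjectiveModules C M') : cProjectiveModules C (M ⊞ M') := by
  obtain ⟨P, hP, ⟨e⟩⟩ := h
  obtain ⟨P', hP', ⟨e'⟩⟩ := h'
  exact ⟨ModuleCat.of R (P × P'), inferInstanceAs (Module.Projective R (P × P')),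
    ⟨biprod.mapIso e e' ≪≫ ModuleCat.biprodIsoProd _ _ ≪≫
      (TensorProduct.prodRight R R C P P').symm.toModuleIso⟩⟩

lemma exists_projective_diskSum_iso {X : ChainComplex (ModuleCat.{u} R) ℤ}
    (hX : complexesOf (projectiveModules R) X) : ∃ P : ℤ → ModuleCat.{u} R,
      (∀ i, Module.Projective R (P i)) ∧ Nonempty (X ≅ diskSum P) :=
  exists_diskSum_iso (fun _ _ hM _ ↦
    have := projective_of_projectiveModules hM
    Ext.subsingleton_of_projective _ _ _) hX

lemma projective_of_complexesOf {X : ChainComplex (ModuleCat.{u} R) ℤ}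
    (hX : complexesOf (projectiveModules R) X) : Projective X := by
  obtain ⟨P, hP, ⟨e⟩⟩ := exists_projective_diskSum_iso hX
  exact Projective.of_iso e.symm
    (diskSum.projective fun i ↦ projective_of_projectiveModules (hP i))

lemma complexesOf_cProjectiveModules_le (C : ModuleCat.{u} R) :
    complexesOf (cProjectiveModules C) ≤ complexesOf (cFlatModules C) := by
  refine fun X hX ↦ ⟨hX.1, fun i ↦ ?_⟩
  obtain ⟨P, hP, e⟩ := hX.2 i
  exact ⟨P, inferInstance, e⟩

lemma subsingleton_ext_target_of_iso {A : Type w} [Category.{v} A] [Abelian A] [HasExt.{u} A]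
    {X B B' : A} (e : B ≅ B') (h : Subsingleton (Ext X B 1)) : Subsingleton (Ext X B' 1) :=
  (IsShortExactSeq.of_iso_zero e.hom (isZero_zero A)).subsingleton_ext_target h
    (subsingleton_of_forall_eq 0 fun x ↦ by
      rw [← Ext.comp_mk₀_id x, (isZero_zero A).eq_of_src (𝟙 _) 0, Ext.mk₀_zero, Ext.comp_zero])

section

variable {C N : ModuleCat.{u} R}
  (hN : ∀ (F : ModuleCat.{u} R) [Module.Flat R F],
    Subsingleton (Ext N (ModuleCat.of R (C ⊗[R] F)) 1))

include hN

lemma subsingleton_ext_tensor_cFlatModules {B : ModuleCat.{u} R} (hB : cFlatModules C B)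
    (P : ModuleCat.{u} R) [Module.Projective R P] :
    Subsingleton (Ext (ModuleCat.of R (N ⊗[R] P)) B 1) := by
  obtain ⟨F, hF, ⟨e⟩⟩ := hB
  exact subsingleton_ext_tensor (subsingleton_ext_target_of_iso e.symm (hN F)) P

/-- Each term of `B` is an extension of two cycle modules, which are `C`-flat, so the degreewise
criterion for disk sums applies. -/
lemma subsingleton_ext_diskSum_tensor [HasExt.{w} (ChainComplex (ModuleCat.{u} R) ℤ)]
    {B : ChainComplex (ModuleCat.{u} R) ℤ} (hB : complexesOf (cFlatModules C) B)
    (P : ℤ → ModuleCat.{u} R) [∀ i, Module.Projective R (P i)] :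
    Subsingleton (Ext (diskSum fun i ↦ ModuleCat.of R (N ⊗[R] P i)) B 1) :=
  diskSum.subsingleton_ext fun i ↦
    (hB.1.isShortExactSeq (i := i) (j := i - 1) (by lia)).subsingleton_ext_target
      (subsingleton_ext_tensor_cFlatModules hN (hB.2 _) (P i))
      (subsingleton_ext_tensor_cFlatModules hN (hB.2 _) (P i))

end

/-- Projective modules are flat, so the hypothesis gives `Ext¹(C ⊗ P, C ⊗ Q) = 0` and the cycles
split off. -/
lemma exists_cProjective_diskSum_iso {C : ModuleCat.{u} R}
    (hC : ∀ (F : ModuleCat.{u} R) [Module.Flat R F],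
      Subsingleton (Ext C (ModuleCat.of R (C ⊗[R] F)) 1))
    {X : ChainComplex (ModuleCat.{u} R) ℤ} (hX : complexesOf (cProjectiveModules C) X) :
    ∃ P : ℤ → ModuleCat.{u} R, (∀ i, Module.Projective R (P i)) ∧
      Nonempty (X ≅ diskSum fun i ↦ ModuleCat.of R (C ⊗[R] P i)) := by
  obtain ⟨N, hN, ⟨e⟩⟩ := exists_diskSum_iso (fun M N hM hN ↦ by
    obtain ⟨P, hP, ⟨e⟩⟩ := hM
    obtain ⟨Q, hQ, e'⟩ := hN
    exact subsingleton_ext_of_iso e.symm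
      (subsingleton_ext_tensor_cFlatModules hC ⟨Q, inferInstance, e'⟩ P)) hX
  choose P hP e' using hN
  obtain ⟨e''⟩ := diskSum.nonempty_iso fun i ↦ (e' i).some
  exact ⟨P, hP, ⟨e ≪≫ e''⟩⟩

lemma complexesOf_tensor {C W : ModuleCat.{u} R}
    (hW : projectiveModules R W ∨ cProjectiveModules C W) (P : ℤ → ModuleCat.{u} R)
    [∀ i, Module.Projective R (P i)] :
    complexesOf (projectiveModules R) (diskSum fun i ↦ ModuleCat.of R (W ⊗[R] P i)) ∨
      complexesOf (cProjectiveModules C) (diskSum fun i ↦ ModuleCat.of R (W ⊗[R] P i)) :=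
  hW.imp
    (fun (_ : Module.Projective R W) ↦ complexesOf_diskSum fun i ↦
      (inferInstanceAs (Module.Projective R (W ⊗[R] P i)) : _))
    fun h ↦ complexesOf_diskSum fun i ↦ cProjectiveModules_tensor h (P i)

theorem IsSemidualizing.isDCProjectiveComplex {C : ModuleCat.{u} R} (hC : IsSemidualizing C)
    {X : ChainComplex (ModuleCat.{u} R) ℤ} {W : ChainComplex (ChainComplex (ModuleCat.{u} R) ℤ) ℤ}
    (hW : W.Acyclic) (hW' : IsHomExact (complexesOf (cFlatModules C)) W)
    (hWi : ∀ i : ℤ, complexesOf (projectiveModules R) (W.X i) ∨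
      complexesOf (cProjectiveModules C) (W.X i)) (e : X ≅ cokernel (W.d 1 0)) :
    IsDCProjectiveComplex C X := by
  let := HasExt.standard (ChainComplex (ModuleCat.{u} R) ℤ)
  obtain ⟨𝒩, hNC, hNF, hleft, hright, ⟨Q, NQ, iQ, pQ, hQ, hNQ, hQC⟩, ⟨NP, P, iP, pP, hP, hNP, hPP⟩⟩ :=
    hC.exists_syzygy_class
  have hCF : ∀ (F : ModuleCat.{u} R) [Module.Flat R F],
    Subsingleton (Ext C (ModuleCat.of R (C ⊗[R] F)) 1) := hNF C hNC
  let 𝒮 : ObjectProperty (ChainComplex (ModuleCat.{u} R) ℤ) := fun Y ↦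
    (∃ j, Nonempty (Y ≅ W.cycles j)) ∨ ∃ N, 𝒩 N ∧ ∃ P : ℤ → ModuleCat.{u} R,
      (∀ i, Module.Projective R (P i)) ∧ Nonempty (Y ≅ diskSum fun i ↦ ModuleCat.of R (N ⊗[R] P i))
  have hdisk (N) (hN : 𝒩 N) (P : ℤ → ModuleCat.{u} R) (hP : ∀ i, Module.Projective R (P i)) :
      𝒮 (diskSum fun i ↦ ModuleCat.of R (N ⊗[R] P i)) := Or.inr ⟨N, hN, P, hP, ⟨Iso.refl _⟩⟩
  -- The cokernel of `W 1 ⟶ W 0` is the cycle object in degree `-1`, hence lies in `𝒮`.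
  obtain ⟨e₀⟩ := hW.nonempty_cokernel_iso (i := 0) (j := -1) (k := 1) (by simp) (by simp)
  refine exists_complete_resolution (𝒮 := 𝒮) (fun _ ↦ projective_of_complexesOf) (fun Y ↦ ?_)
    (complexesOf_cProjectiveModules_le C) (fun Y Z hY hZ ↦ ?_) ?_ ?_ ?_ ?_ ?_
    (Or.inl ⟨-1, ⟨e ≪≫ e₀.symm⟩⟩)
  · obtain ⟨N, p, hN, hp⟩ := diskSum.exists_epi Y
    exact ⟨_, p, complexesOf_diskSum fun i ↦ projectiveModules_of_projective (N i), hp⟩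
  · obtain ⟨P, hP, ⟨f⟩⟩ := exists_cProjective_diskSum_iso hCF hY
    obtain ⟨P', hP', ⟨f'⟩⟩ := exists_cProjective_diskSum_iso hCF hZ
    obtain ⟨f''⟩ := diskSum.nonempty_biprod_iso (fun i ↦ ModuleCat.of R (C ⊗[R] P i))
      (fun i ↦ ModuleCat.of R (C ⊗[R] P' i))
    exact complexesOf_of_iso (biprod.mapIso f f' ≪≫ f'').symm (complexesOf_diskSum fun i ↦
      cProjectiveModules_biprod (cProjectiveModules_tensor (cProjectiveModules_self C) _)
        (cProjectiveModules_tensor (cProjectiveModules_self C) _))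
  · rintro S B (⟨j, ⟨f⟩⟩ | ⟨N, hN, P, hP, ⟨f⟩⟩) hB
    · refine subsingleton_ext_of_iso f.symm (hW'.subsingleton_ext_cycles hW hB (fun i ↦ ?_) j)
      obtain hi | hi := hWi i
      · have := projective_of_complexesOf hi
        exact Ext.subsingleton_of_projective _ _ _
      · obtain ⟨P, hP, ⟨g⟩⟩ := exists_cProjective_diskSum_iso hCF hi
        exact subsingleton_ext_of_iso g.symm (subsingleton_ext_diskSum_tensor hCF hB P)
    · exact subsingleton_ext_of_iso f.symm (subsingleton_ext_diskSum_tensor (hNF N hN) hB P)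
  · rintro S (⟨j, ⟨f⟩⟩ | ⟨N, hN, P, hP, ⟨f⟩⟩)
    · exact ⟨_, _, _, _, (hW.isShortExactSeq (i := j + 1) rfl).postcomp_iso f.symm,
        Or.inl ⟨_, ⟨Iso.refl _⟩⟩, hWi _⟩
    · obtain ⟨N', V, i, p, h, hN', hV⟩ := hleft N hN
      obtain ⟨a, b, hab, -⟩ := diskSum.exists_isShortExactSeq fun i ↦ h.tensor (P i)
      exact ⟨_, _, _, _, hab.postcomp_iso f.symm, hdisk N' hN' P hP, complexesOf_tensor hV P⟩
  · rintro S (⟨j, ⟨f⟩⟩ | ⟨N, hN, P, hP, ⟨f⟩⟩)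
    · exact ⟨_, _, _, _, (hW.isShortExactSeq (i := j) (j := j - 1) (by lia)).precomp_iso f,
        Or.inl ⟨_, ⟨Iso.refl _⟩⟩, hWi _⟩
    · obtain ⟨V, N', i, p, h, hN', hV⟩ := hright N hN
      obtain ⟨a, b, hab, -⟩ := diskSum.exists_isShortExactSeq fun i ↦ h.tensor (P i)
      exact ⟨_, _, _, _, hab.precomp_iso f, hdisk N' hN' P hP, complexesOf_tensor hV P⟩
  -- With `V` written as the disk sum of the `R ⊗ P' i`, the embedding of `R` into a `C`-projective
  -- module is tensored with each `P' i`.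
  · intro V hV
    obtain ⟨P', hP', ⟨f⟩⟩ := exists_projective_diskSum_iso hV
    obtain ⟨f'⟩ := diskSum.nonempty_iso (N := P') (N' := fun i ↦ ModuleCat.of R (R ⊗[R] P' i))
      fun i ↦ (TensorProduct.lid R (P' i)).symm.toModuleIso
    obtain ⟨a, b, hab, -⟩ := diskSum.exists_isShortExactSeq fun i ↦ hQ.tensor (P' i)
    exact ⟨_, _, _, _, hab.precomp_iso (f ≪≫ f'), hdisk NQ hNQ P' hP',
      complexesOf_diskSum fun i ↦ cProjectiveModules_tensor hQC (P' i)⟩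
  -- Likewise, the projective cover of `C` in the first syzygy sequence is tensored with each `P'
  -- i`.
  · intro V hV
    obtain ⟨P', hP', ⟨f⟩⟩ := exists_cProjective_diskSum_iso hCF hV
    obtain ⟨a, b, hab, -⟩ := diskSum.exists_isShortExactSeq fun i ↦ hP.tensor (P' i)
    have hPP : Module.Projective R P := hPP
    exact ⟨_, _, _, _, hab.postcomp_iso f.symm, hdisk NP hNP P' hP',
      complexesOf_diskSum fun i ↦ (inferInstanceAs (Module.Projective R (P ⊗[R] P' i)) : _)⟩

end ComplexesOf

theorem corollary2p17 {R : Type u} [CommRing R] (C : ModuleCat.{u} R) (hC : IsSemidualizing C)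
    (X : ChainComplex (ModuleCat.{u} R) ℤ) :
    IsDCProjectiveComplex C X ↔
      ∃ W : ChainComplex (ChainComplex (ModuleCat.{u} R) ℤ) ℤ,
        W.Acyclic ∧ IsHomExact (complexesOf (cFlatModules C)) W ∧
        (∀ i : ℤ, complexesOf (projectiveModules R) (W.X i) ∨
          complexesOf (cProjectiveModules C) (W.X i)) ∧
        Nonempty (X ≅ cokernel (W.d 1 0)) := by
  constructor
  · rintro ⟨E, hE, hE', h₁, h₂, ⟨e⟩⟩
    obtain ⟨e₁⟩ := hE.nonempty_image_iso (i := 0) (j := -1) (by simp)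
    obtain ⟨e₂⟩ := hE.nonempty_cokernel_iso (i := 0) (j := -1) (k := 1) (by simp) (by simp)
    exact ⟨E, hE, hE', fun i ↦ (le_or_gt 0 i).imp (h₁ i) (h₂ i), ⟨e ≪≫ e₁.symm ≪≫ e₂⟩⟩
  · rintro ⟨W, hW, hW', hWi, ⟨e⟩⟩
    exact hC.isDCProjectiveComplex hW hW' hWi e
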